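/- Let $n\ge1$. For an increasing $\Phi:[0,\infty]\to[0,\infty]$ put $a(\Phi)=\sup\{t:\Phi(t)=0\}$ ($\sup\emptyset=0$) and $b(\Phi)=\inf\{t:\Phi(t)=\infty\}$ ($\inf\emptyset=\infty$). Let $\overline{\boldsymbol\Phi}$ be the set of increasing $\Phi$ with $a(\Phi)<\infty$, $b(\Phi)>0$, $\lim_{t\to0+}\Phi(t)=\Phi(0)=0$, $\Phi$ left continuous on $[0,b(\Phi))$, $\lim_{t\to\infty}\Phi(t)=\Phi(\infty)=\infty$ if $b(\Phi)=\infty$, and $\lim_{t\to b(\Phi)-0}\Phi(t)=\Phi(b(\Phi))\,(\le\infty)$ if $b(\Phi)<\infty$. For such $\Phi$ let $\Phi^{-1}(u)=\inf\{t\ge0:\Phi(t)>u\}$ for $u<\infty$ and $\Phi^{-1}(\infty)=\infty$. A Young function is a $\Phi\in\overline{\boldsymbol\Phi}$ that is convex on $[0,b(\Phi))$; $\overline{\boldsymbol\Phi}_Y$ is the set of $\Phi\in\overline{\boldsymbol\Phi}$ for which there are a Young function $\Psi$ and $C>0$ with $\Phi(C^{-1}t)\le\Psi(t)\le\Phi(Ct)$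 for all $t\in[0,\infty]$. Let $\overline\Delta_2$ be the set of $\Phi\in\overline{\boldsymbol\Phi}$ such that, for some $C>0$, $\Phi(2t)\le C\Phi(t)$ for all $t>0$, and $\overline\nabla_2$ the set of $\Phi\in\overline{\boldsymbol\Phi}$ such that, for some $k>1$, $\Phi(t)\le\frac1{2k}\Phi(kt)$ for all $t>0$. For functions $P,Q$ on $[0,\infty]$, $P\lesssim Q$ means $P\le CQ$ for some constant $C>0$, and $P\sim Q$ means $P\lesssim Q\lesssim P$. Let $\mathcal G^{\rm dec}$ be the set of $\varphi:(0,\infty)\to(0,\infty)$ such that for some $C>0$, $\varphi(s)\le C\varphi(r)$ and $\varphi(r)r^n\le C\varphi(s)s^n$ whenever $0<r<s$. For $\varphi:(0,\infty)\to(0,\infty)$, $\Phi\in\overline{\boldsymbol\Phi}$ and a ball $B=B(a,r)\subset\mathbb R^n$ let $$\|f\|_{\Phi,\varphi,B}=\inf\Big\{\lambda>0:\frac1{\varphi(r)}\,\frac1{|B|}\int_B\Phi\Big(\frac{|f(x)|}{\lambda}\Big)dx\le1\Big\}.$$ Let $L^{(\Phi,\varphi)}(\mathbb R^n)$ be the set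 of measurable (real- or complex-valued) $f$ with $\|f\|_{L^{(\Phi,\varphi)}}=\sup_B\|f\|_{\Phi,\varphi,B}<\infty$, and $\mathcal L^{(\Phi,\varphi)}(\mathbb R^n)$ the set of $f\in L^1_{\rm loc}(\mathbb R^n)$ with $\|f\|_{\mathcal L^{(\Phi,\varphi)}}=\sup_B\|f-f_B\|_{\Phi,\varphi,B}<\infty$, where $f_B=\frac1{|B|}\int_Bf$ and the suprema are over all balls. For a measurable $\rho:(0,\infty)\to(0,\infty)$ let $$I_\rho f(x)=\int_{\mathbb R^n}\frac{\rho(|x-y|)}{|x-y|^n}f(y)\,dy,\qquad [b,I_\rho]f=b\,I_\rho f-I_\rho(bf).$$ **Theorem.** Let $\Phi\in\overline\nabla_2$, $\Phi_0\in\overline\Delta_2$, $\Psi\in\overline{\boldsymbol\Phi}_Y$ and $\varphi\in\mathcal G^{\rm dec}$. Assume that there is $C>0$ with $\int_r^\infty\frac{\varphi(t)}t\,dt\le C\varphi(r)$ for all $r>0$; that $\int_0^1\frac{\rho(t)}t\,dt<\infty$; and that there are $C>0$ and $0<K_1<K_2$ with $\sup_{r\le t\le2r}\rho(t)\le C\int_{K_1r}^{K_2r}\frac{\rho(t)}t\,dt$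 for all $r>0$. Assume also that there exist $\Psi_0\in\overline\nabla_2$, $\Theta\in\overline{\boldsymbol\Phi}_Y$ and $C_0>0$ such that $\Phi^{-1}\Phi_0^{-1}\sim\Psi_0^{-1}$, $\Phi_0^{-1}\Theta^{-1}\lesssim\Psi^{-1}$ and $$\int_0^r\frac{\rho(t)}t\,dt\;\Phi^{-1}(\varphi(r))+\int_r^\infty\frac{\rho(t)\,\Phi^{-1}(\varphi(t))}t\,dt\le C_0\,\Theta^{-1}(\varphi(r))\qquad\text{for all }r>0.$$ Then there is a constant $C>0$ such that, for all $b\in\mathcal L^{(\Phi_0,\varphi)}(\mathbb R^n)$ and all $f\in L^{(\Phi,\varphi)}(\mathbb R^n)$, the commutator $[b,I_\rho]f$ is well defined (for almost every $x$ the integrals defining $I_\rho f(x)$ and $I_\rho(bf)(x)$ converge absolutely), belongs to $L^{(\Psi,\varphi)}(\mathbb R^n)$, and satisfies $$\|[b,I_\rho]f\|_{L^{(\Psi,\varphi)}}\le C\,\|b\|_{\mathcal L^{(\Phi_0,\varphi)}}\,\|f\|_{L^{(\Phi,\varphi)}}.$$ -/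

import Mathlib

open MeasureTheory Set Filter Topology
open scoped ENNReal NNReal

noncomputable section

namespace OrliczMorrey

/-! ### Generalized Young functions `[0,∞] → [0,∞]` -/

/-- `a(Φ) = sup {t ≥ 0 : Φ t = 0}` (with `sup ∅ = 0`). -/
def zeroEnd (Φ : ℝ≥0∞ → ℝ≥0∞) : ℝ≥0∞ := sSup {t | Φ t = 0}

/-- `b(Φ) = inf {t ≥ 0 : Φ t = ∞}` (with `inf ∅ = ∞`). -/
def finEnd (Φ : ℝ≥0∞ → ℝ≥0∞) : ℝ≥0∞ := sInf {t | Φ t = ∞}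

/-- The class of increasing functions `Φ : [0,∞] → [0,∞]` underlying the theory: `a(Φ) < ∞`,
`b(Φ) > 0`, `Φ` vanishes at `0` and tends to `0` there, is left continuous on `[0, b(Φ))`, and has
the prescribed behaviour at `b(Φ)`. -/
structure IsPhi (Φ : ℝ≥0∞ → ℝ≥0∞) : Prop where
  mono : Monotone Φ
  zeroEnd_lt_top : zeroEnd Φ < ∞
  finEnd_pos : 0 < finEnd Φ
  map_zero : Φ 0 = 0
  tendsto_zero : Tendsto Φ (𝓝[>] 0) (𝓝 0)
  left_cont : ∀ t < finEnd Φ, ContinuousWithinAt Φ (Iic t) t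
  at_top : finEnd Φ = ∞ → Tendsto Φ (𝓝[<] ∞) (𝓝 ∞) ∧ Φ ∞ = ∞
  at_finEnd : finEnd Φ < ∞ → Tendsto Φ (𝓝[<] finEnd Φ) (𝓝 (Φ (finEnd Φ)))

/-- The generalized inverse (in the sense of O'Neil):
`Φ⁻¹(u) = inf {t ≥ 0 : Φ t > u}` for `u < ∞`, and `Φ⁻¹(∞) = ∞`. -/
def ginv (Φ : ℝ≥0∞ → ℝ≥0∞) (u : ℝ≥0∞) : ℝ≥0∞ :=
  if u = ∞ then ∞ else sInf {t | u < Φ t}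

/-- Equivalence by dilations: `Φ(C⁻¹ t) ≤ Ψ(t) ≤ Φ(C t)` for all `t ∈ [0,∞]`. -/
def DilEquiv (Φ Ψ : ℝ≥0∞ → ℝ≥0∞) : Prop :=
  ∃ C : ℝ≥0, 0 < C ∧ ∀ t : ℝ≥0∞, Φ ((C : ℝ≥0∞)⁻¹ * t) ≤ Ψ t ∧ Ψ t ≤ Φ ((C : ℝ≥0∞) * t)

/-- `P ≲ Q` on `[0,∞]`. -/
def Dominated (P Q : ℝ≥0∞ → ℝ≥0∞) : Prop :=
  ∃ C : ℝ≥0, 0 < C ∧ ∀ t : ℝ≥0∞, P t ≤ (C : ℝ≥0∞) * Q t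

/-- `P ∼ Q` on `[0,∞]`. -/
def Comparable (P Q : ℝ≥0∞ → ℝ≥0∞) : Prop :=
  ∃ C : ℝ≥0, 0 < C ∧ ∀ t : ℝ≥0∞, (C : ℝ≥0∞)⁻¹ * P t ≤ Q t ∧ Q t ≤ (C : ℝ≥0∞) * P t

/-- Young functions: members of the class `IsPhi` that are convex on `[0, b(Φ))`. -/
structure IsYoung (Φ : ℝ≥0∞ → ℝ≥0∞) : Prop where
  isPhi : IsPhi Φ
  convex : ConvexOn ℝ≥0 (Iio (finEnd Φ)) Φ

/-- Generalized Young functions: members of the class `IsPhi` that are equivalent by dilations to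
a Young function. -/
structure IsGenYoung (Φ : ℝ≥0∞ → ℝ≥0∞) : Prop where
  isPhi : IsPhi Φ
  equiv_young : ∃ Ψ : ℝ≥0∞ → ℝ≥0∞, IsYoung Ψ ∧ DilEquiv Φ Ψ

/-- The `Δ₂`-condition (convexity is not required): `Φ(2t) ≤ C Φ(t)` for all `t > 0`. -/
structure IsDelta2 (Φ : ℝ≥0∞ → ℝ≥0∞) : Prop where
  isPhi : IsPhi Φ
  doubling : ∃ C : ℝ≥0, 0 < C ∧ ∀ t : ℝ≥0∞, 0 < t → Φ (2 * t) ≤ (C : ℝ≥0∞) * Φ t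

/-- The `∇₂`-condition (convexity is not required): `Φ(t) ≤ Φ(k t) / (2k)` for all `t > 0`, for
some `k > 1`. -/
structure IsNabla2 (Φ : ℝ≥0∞ → ℝ≥0∞) : Prop where
  isPhi : IsPhi Φ
  nabla : ∃ k : ℝ≥0, 1 < k ∧
    ∀ t : ℝ≥0∞, 0 < t → Φ t ≤ (2 * (k : ℝ≥0∞))⁻¹ * Φ ((k : ℝ≥0∞) * t)

/-! ### Functions on `(0,∞)`

A function `(0,∞) → (0,∞)` is represented by a function `ℝ → ℝ` that is positive on `(0,∞)`; its
values elsewhere play no role. -/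

/-- The class `𝒢^dec` in dimension `n`: `φ` is almost decreasing and `r ↦ φ(r) rⁿ` is almost
increasing. -/
structure IsGdec (n : ℕ) (φ : ℝ → ℝ) : Prop where
  pos : ∀ r, 0 < r → 0 < φ r
  almost : ∃ C : ℝ, 0 < C ∧ ∀ r s : ℝ, 0 < r → r < s →
    φ s ≤ C * φ r ∧ φ r * r ^ n ≤ C * (φ s * s ^ n)

/-- The integral condition `∫_r^∞ φ(t)/t dt ≤ C φ(r)` for all `r > 0`. -/
def IntegralCondition (φ : ℝ → ℝ) : Prop :=
  ∃ C : ℝ≥0, 0 < C ∧ ∀ r : ℝ, 0 < r →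
    ∫⁻ t in Ioi r, ENNReal.ofReal (φ t / t) ≤ (C : ℝ≥0∞) * ENNReal.ofReal (φ r)

/-- The standing conditions on `ρ : (0,∞) → (0,∞)`: (Lebesgue measurability,)
`∫_0^1 ρ(t)/t dt < ∞`, and `sup_{r ≤ t ≤ 2r} ρ(t) ≤ C ∫_{K₁r}^{K₂r} ρ(t)/t dt` for all `r > 0`, for
some constants `C > 0` and `0 < K₁ < K₂`. -/
structure IsFractionalKernel (ρ : ℝ → ℝ) : Prop where
  pos : ∀ r, 0 < r → 0 < ρ r
  aemeasurable : AEMeasurable ρ (volume.restrict (Ioi 0))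
  integrable_zero : ∫⁻ t in Ioo 0 1, ENNReal.ofReal (ρ t / t) < ∞
  sup_le : ∃ (C : ℝ≥0) (K₁ K₂ : ℝ), 0 < C ∧ 0 < K₁ ∧ K₁ < K₂ ∧ ∀ r : ℝ, 0 < r →
    ⨆ t ∈ Icc r (2 * r), ENNReal.ofReal (ρ t) ≤
      (C : ℝ≥0∞) * ∫⁻ t in Ioo (K₁ * r) (K₂ * r), ENNReal.ofReal (ρ t / t)

/-- The condition
`∫_0^r ρ(t)/t dt · Φ⁻¹(φ(r)) + ∫_r^∞ ρ(t) Φ⁻¹(φ(t))/t dt ≤ C₀ Θ⁻¹(φ(r))` for all `r > 0`. -/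
def FractionalCondition (ρ φ : ℝ → ℝ) (Φ Θ : ℝ≥0∞ → ℝ≥0∞) : Prop :=
  ∃ C₀ : ℝ≥0, 0 < C₀ ∧ ∀ r : ℝ, 0 < r →
    (∫⁻ t in Ioo 0 r, ENNReal.ofReal (ρ t / t)) * ginv Φ (ENNReal.ofReal (φ r)) +
      ∫⁻ t in Ioi r, ENNReal.ofReal (ρ t / t) * ginv Φ (ENNReal.ofReal (φ t)) ≤
    (C₀ : ℝ≥0∞) * ginv Θ (ENNReal.ofReal (φ r))

/-! ### Function spaces on `ℝⁿ` -/

variable {n : ℕ} {𝕜 : Type*} [RCLike 𝕜]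

/-- `‖f‖_{Φ,φ,B} = inf {c > 0 : φ(r)⁻¹ ⨍_B Φ(|f|/c) ≤ 1}` for the ball `B = B(a,r)`. -/
def ballNorm (Φ : ℝ≥0∞ → ℝ≥0∞) (φ : ℝ → ℝ) (a : EuclideanSpace ℝ (Fin n)) (r : ℝ)
    (f : EuclideanSpace ℝ (Fin n) → 𝕜) : ℝ≥0∞ :=
  sInf {c : ℝ≥0∞ | 0 < c ∧ c ≠ ∞ ∧
    (ENNReal.ofReal (φ r))⁻¹ * ⨍⁻ x in Metric.ball a r, Φ (‖f x‖ₑ / c) ∂volume ≤ 1}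

/-- The Orlicz-Morrey (quasi-)norm: the supremum over all balls of `‖f‖_{Φ,φ,B}`. -/
def morreyNorm (Φ : ℝ≥0∞ → ℝ≥0∞) (φ : ℝ → ℝ) (f : EuclideanSpace ℝ (Fin n) → 𝕜) : ℝ≥0∞ :=
  ⨆ (a : EuclideanSpace ℝ (Fin n)) (r : ℝ) (_ : 0 < r), ballNorm Φ φ a r f

/-- Membership in the Orlicz-Morrey space `L^{(Φ,φ)}(ℝⁿ)`. -/
def MemMorrey (Φ : ℝ≥0∞ → ℝ≥0∞) (φ : ℝ → ℝ) (f : EuclideanSpace ℝ (Fin n) → 𝕜) : Prop :=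
  AEStronglyMeasurable f volume ∧ morreyNorm Φ φ f < ∞

/-- The Orlicz-Campanato (quasi-)norm: the supremum over all balls of `‖f - f_B‖_{Φ,φ,B}`. -/
def campanatoNorm (Φ : ℝ≥0∞ → ℝ≥0∞) (φ : ℝ → ℝ) (f : EuclideanSpace ℝ (Fin n) → 𝕜) : ℝ≥0∞ :=
  ⨆ (a : EuclideanSpace ℝ (Fin n)) (r : ℝ) (_ : 0 < r),
    ballNorm Φ φ a r (fun x => f x - ⨍ y in Metric.ball a r, f y ∂volume)

/-- Membership in the Orlicz-Campanato space `ℒ^{(Φ,φ)}(ℝⁿ)`. -/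
def MemCampanato (Φ : ℝ≥0∞ → ℝ≥0∞) (φ : ℝ → ℝ) (f : EuclideanSpace ℝ (Fin n) → 𝕜) : Prop :=
  LocallyIntegrable f volume ∧ campanatoNorm Φ φ f < ∞

/-! ### The fractional integral operator and its commutator -/

/-- The integrand `y ↦ ρ(|x-y|) |x-y|⁻ⁿ f(y)` of the generalized fractional integral at `x`. -/
def fracIntegrand (ρ : ℝ → ℝ) (f : EuclideanSpace ℝ (Fin n) → 𝕜)
    (x y : EuclideanSpace ℝ (Fin n)) : 𝕜 :=
  (ρ ‖x - y‖ / ‖x - y‖ ^ n) • f y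

/-- The generalized fractional integral operator `I_ρ`. -/
def fracIntegral (ρ : ℝ → ℝ) (f : EuclideanSpace ℝ (Fin n) → 𝕜)
    (x : EuclideanSpace ℝ (Fin n)) : 𝕜 :=
  ∫ y, fracIntegrand ρ f x y ∂volume

/-- The commutator `[b, I_ρ] f = b I_ρ f - I_ρ (b f)`. -/
def fracCommutator (ρ : ℝ → ℝ) (b f : EuclideanSpace ℝ (Fin n) → 𝕜)
    (x : EuclideanSpace ℝ (Fin n)) : 𝕜 :=
  b x * fracIntegral ρ f x - fracIntegral ρ (fun y => b y * f y) x

end OrliczMorrey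

end

open OrliczMorrey

namespace OrliczMorrey

/-! ### Generalized inverses -/

section Inverse

variable {Φ Φ₀ Ψ : ℝ≥0∞ → ℝ≥0∞}

/-! The commutator ignores constants in `b`: [b, I_ρ] = [b - σ, I_ρ]. The condition ∫_r^∞ φ(t)/t dt
≲ φ(r) forces φ to decay geometrically along the powers of a large λ, and Δ₂ turns this into
geometric decay of Φ₀⁻¹(φ(λ^i r)). Hence the averages of `b` over growing balls converge to a single
constant σ, and b - σ belongs to the Orlicz-Morrey space of Φ₀
(`IsDelta2.exists_modularLE_sub_const`).

After that no cancellation is needed: |[b, I_ρ]f| ≤ |b - σ| I_ρ|f| + I_ρ(|b - σ||f|), and each term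
takes one Hölder inequality and one bound for I_ρ. In the first, I_ρ maps Φ to Θ and Hölder uses
Φ₀⁻¹Θ⁻¹ ≲ Ψ⁻¹. In the second, Hölder places (b - σ)f in the space of Ψ₀, and I_ρ maps Ψ₀ to Ψ,
because Φ₀⁻¹(φ(t)) ≲ Φ₀⁻¹(φ(r)) for t ≥ r transfers the integral condition to this pair
(`FractionalCondition.of_comparable`).

The bound for I_ρ (`IsNabla2.exists_modularLE_potential`) is Hedberg's method: splitting the
integral at a radius R with Φ⁻¹(φ(R)) comparable to the maximal function MF(x) gives Θ(I_ρF/D) ≤ C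
Φ(MF/L) pointwise, and ∇₂ yields the modular inequality for MF
(`IsNabla2.exists_modularLE_maximal`).

Everything is run on modular inequalities ⨍_B Φ(F) ≤ φ(r) instead of norms. Convexity enters only
through `QuasiConvex`, which absorbs constant factors into dilations and replaces Jensen's
inequality; it holds for all five functions involved, Φ₀ inheriting it from Φ and Ψ₀. -/

lemma ginv_mono (Φ : ℝ≥0∞ → ℝ≥0∞) : Monotone (ginv Φ) := by
  intro u v huv
  unfold ginv
  split_ifs with h1 h2 h2
  · exact le_rfl
  · exact absurd (top_le_iff.1 (h1 ▸ huv)) h2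
  · exact le_top
  · exact sInf_le_sInf fun t ht => lt_of_le_of_lt huv ht

lemma le_ginv_apply (hΦ : Monotone Φ) (s : ℝ≥0∞) : s ≤ ginv Φ (Φ s) := by
  unfold ginv
  split_ifs with h
  · exact le_top
  · exact le_sInf fun t ht => (hΦ.reflect_lt ht).le

lemma ginv_le_of_lt {u t : ℝ≥0∞} (h : u < Φ t) : ginv Φ u ≤ t := by
  unfold ginv
  rw [if_neg (ne_top_of_lt h)]
  exact sInf_le h

lemma apply_le_of_lt_ginv {u s : ℝ≥0∞} (h : s < ginv Φ u) : Φ s ≤ u := by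
  by_contra! hc
  exact absurd (ginv_le_of_lt hc) (not_le.2 h)

lemma exists_of_ginv_lt {u s : ℝ≥0∞} (h : ginv Φ u < s) : ∃ t < s, u < Φ t := by
  unfold ginv at h
  split_ifs at h with hu
  · exact absurd h not_top_lt
  · obtain ⟨t, ht, hts⟩ := sInf_lt_iff.1 h
    exact ⟨t, hts, ht⟩

lemma lt_apply_of_ginv_lt (hΦ : Monotone Φ) {u s : ℝ≥0∞} (h : ginv Φ u < s) : u < Φ s := by
  obtain ⟨t, hts, ht⟩ := exists_of_ginv_lt h
  exact ht.trans_le (hΦ hts.le)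

/-- The tool behind every comparison of inverses: a bound at each point of the superlevel set passes
to its infimum. The value at `∞` is set by convention, hence `u ≠ ∞`. -/
lemma le_mul_ginv_of_forall {u : ℝ≥0∞} (hu : u ≠ ∞) {x C : ℝ≥0∞} (hC0 : C ≠ 0)
    (hC : C ≠ ∞) (h : ∀ t, u < Φ t → x ≤ C * t) : x ≤ C * ginv Φ u := by
  rw [ginv, if_neg hu, mul_comm, ← ENNReal.div_le_iff hC0 hC]
  exact le_sInf fun t ht => ENNReal.div_le_of_le_mul' (h t ht)

lemma IsPhi.ginv_lt_top (hΦ : IsPhi Φ) {u : ℝ≥0∞} (hu : u ≠ ∞) : ginv Φ u < ∞ := by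
  by_cases hb : finEnd Φ = ∞
  · have h := (hΦ.at_top hb).1.eventually (lt_mem_nhds (lt_top_iff_ne_top.2 hu))
    have : (𝓝[<] (∞ : ℝ≥0∞)).NeBot := nhdsLT_neBot_of_exists_lt ⟨0, by simp⟩
    obtain ⟨t, ht, htt⟩ := (h.and self_mem_nhdsWithin).exists
    exact (ginv_le_of_lt ht).trans_lt htt
  · obtain ⟨t, ht, htt⟩ := sInf_lt_iff.1 (lt_top_iff_ne_top.2 hb)
    exact (ginv_le_of_lt (Φ := Φ) (u := u) (t := t)
      (by rw [show Φ t = ∞ from ht]; exact lt_top_iff_ne_top.2 hu)).trans_lt htt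

lemma IsPhi.ginv_pos (hΦ : IsPhi Φ) {u : ℝ≥0∞} (hu : u ≠ 0) : 0 < ginv Φ u := by
  have h := hΦ.tendsto_zero.eventually (gt_mem_nhds (pos_iff_ne_zero.2 hu))
  have : (𝓝[>] (0 : ℝ≥0∞)).NeBot := nhdsGT_neBot_of_exists_gt ⟨1, by simp⟩
  obtain ⟨t, ht, htt⟩ := (h.and self_mem_nhdsWithin).exists
  refine lt_of_lt_of_le htt ?_
  by_contra! hc
  exact absurd (lt_apply_of_ginv_lt hΦ.mono hc) (not_lt.2 ht.le)

/-- Strictly below the infimum Φ stays at most `u`; halving gets there without any use of left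
continuity. This is the source of most factors 2 below. -/
lemma IsPhi.apply_half_ginv_le (hΦ : IsPhi Φ) (u : ℝ≥0∞) : Φ (ginv Φ u / 2) ≤ u := by
  by_cases hu : u = ∞
  · simp [hu]
  rcases eq_or_ne (ginv Φ u) 0 with h0 | h0
  · simp [h0, hΦ.map_zero]
  · exact apply_le_of_lt_ginv (ENNReal.half_lt_self h0 (hΦ.ginv_lt_top hu).ne)

lemma IsPhi.apply_top (hΦ : IsPhi Φ) : Φ ∞ = ∞ := by
  by_contra hc
  exact absurd (le_ginv_apply hΦ.mono ∞) (not_le.2 (hΦ.ginv_lt_top hc))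

/-- The pointwise form of Hölder's inequality for generalized Young functions. -/
lemma IsPhi.apply_mul_le (hΨ : IsPhi Ψ) (hΦ : Monotone Φ) (hΦ₀ : Monotone Φ₀) {C : ℝ≥0}
    (hC : 0 < C) (h : ∀ u, ginv Φ u * ginv Φ₀ u ≤ C * ginv Ψ u) (s t : ℝ≥0∞) :
    Ψ (s * t / (2 * C)) ≤ Φ s + Φ₀ t := by
  -- At this common level `s` and `t` lie below the respective inverses, so the product hypothesis
  -- applies once.
  set u := Φ s + Φ₀ t
  have h1 : s * t ≤ C * ginv Ψ u := by
    refine le_trans (mul_le_mul' ?_ ?_) (h u)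
    · exact (le_ginv_apply hΦ s).trans (ginv_mono Φ le_self_add)
    · exact (le_ginv_apply hΦ₀ t).trans (ginv_mono Φ₀ le_add_self)
  refine le_trans (hΨ.mono ?_) (hΨ.apply_half_ginv_le u)
  rw [ENNReal.div_le_iff (by simp [hC.ne']) (by finiteness)]
  refine h1.trans (le_of_eq ?_)
  rw [div_eq_mul_inv, show ginv Ψ u * 2⁻¹ * (2 * (C : ℝ≥0∞)) = C * ginv Ψ u * (2⁻¹ * 2) by ring,
    ENNReal.inv_mul_cancel (by simp) (by simp), mul_one]

/-- At most linear growth of the generalized inverse: a quantitative form of quasi-convexity. -/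
def QuasiConvex (Φ : ℝ≥0∞ → ℝ≥0∞) : Prop :=
  ∃ C : ℝ≥0, 1 ≤ C ∧ ∀ (l : ℝ≥0) (u : ℝ≥0∞), 1 ≤ l → u ≠ 0 → u ≠ ∞ →
    ginv Φ (l * u) ≤ C * l * ginv Φ u

/-- Linear growth at the level v = Φ(t)/l gives t ≤ C l Φ⁻¹(v), so t/(2Cl) lies below half the
inverse at v. The levels 0 and ∞, which `QuasiConvex` leaves out, are trivial. -/
lemma QuasiConvex.exists_apply_div_le (hΦ : IsPhi Φ) (h : QuasiConvex Φ) {l : ℝ≥0} (hl : 1 ≤ l) :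
    ∃ D : ℝ≥0, 1 ≤ D ∧ ∀ t, Φ (t / D) ≤ Φ t / l := by
  obtain ⟨C, hC, h⟩ := h
  have hl0 : (l : ℝ≥0∞) ≠ 0 := by simpa using (zero_lt_one.trans_le hl).ne'
  refine ⟨2 * (C * l), ?_, fun t => ?_⟩
  · calc (1 : ℝ≥0) = 1 * (1 * 1) := by norm_num
      _ ≤ 2 * (C * l) := by gcongr; norm_num
  have hD : (1 : ℝ≥0∞) ≤ (2 * (C * l) : ℝ≥0) := by
    have : (1 : ℝ≥0) ≤ 2 * (C * l) := by
      calc (1 : ℝ≥0) = 1 * (1 * 1) := by norm_num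
        _ ≤ 2 * (C * l) := by gcongr; norm_num
    exact_mod_cast this
  rcases eq_or_ne (Φ t) ∞ with ht | ht
  · simp [ht, ENNReal.top_div]
  rcases eq_or_ne (Φ t) 0 with ht0 | ht0
  · rw [ht0, ENNReal.zero_div, ← ht0]
    refine hΦ.mono ?_
    exact ENNReal.div_le_of_le_mul (le_mul_of_one_le_right' hD)
  have h1 : t ≤ C * l * ginv Φ (Φ t / l) := by
    refine (le_ginv_apply hΦ.mono t).trans ?_
    have := h l (Φ t / l) hl (by simp [ENNReal.div_eq_zero_iff, ht0])
      (ENNReal.div_ne_top ht hl0)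
    rwa [ENNReal.mul_div_cancel hl0 (by simp)] at this
  refine le_trans (hΦ.mono ?_) (hΦ.apply_half_ginv_le (Φ t / l))
  refine ENNReal.div_le_of_le_mul (h1.trans (le_of_eq ?_))
  push_cast
  rw [ENNReal.div_eq_inv_mul (b := 2), show ∀ x : ℝ≥0∞, 2⁻¹ * x * (2 * ((C : ℝ≥0∞) * l)) =
    C * l * x * (2⁻¹ * 2) by intro x; ring, ENNReal.inv_mul_cancel (by simp) (by simp), mul_one]

/-- A majorant of `s` that is affine in Φ(s), playing the part of the supporting line in Jensen's
inequality: it is clear when Φ(s) ≤ u, and otherwise is linear growth with l = Φ(s)/u. -/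
lemma QuasiConvex.exists_le_ginv_mul (hΦ : IsPhi Φ) (h : QuasiConvex Φ) :
    ∃ C : ℝ≥0, 1 ≤ C ∧ ∀ u s : ℝ≥0∞, u ≠ 0 → u ≠ ∞ → s ≤ C * ginv Φ u * (1 + Φ s / u) := by
  obtain ⟨C, hC, h⟩ := h
  refine ⟨C, hC, fun u s hu0 hu => ?_⟩
  have hC' : (1 : ℝ≥0∞) ≤ C := by exact_mod_cast hC
  rcases le_total (Φ s) u with hs | hs
  · calc s ≤ ginv Φ (Φ s) := le_ginv_apply hΦ.mono s
      _ ≤ 1 * ginv Φ u * 1 := by simpa using ginv_mono Φ hs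
      _ ≤ _ := by gcongr; exact le_self_add
  rcases eq_or_ne (Φ s) ∞ with hst | hst
  · rw [hst, ENNReal.top_div_of_ne_top hu, add_top, ENNReal.mul_top]
    · exact le_top
    · exact mul_ne_zero (by positivity) (hΦ.ginv_pos hu0).ne'
  have hl : Φ s / u ≠ ∞ := ENNReal.div_ne_top hst hu0
  have h1 : 1 ≤ (Φ s / u).toNNReal := by
    rw [← ENNReal.coe_le_coe, ENNReal.coe_toNNReal hl]
    exact (ENNReal.le_div_iff_mul_le (.inl hu0) (.inl hu)).2 (by simpa using hs)
  have h2 := h _ u h1 hu0 hu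
  rw [ENNReal.coe_toNNReal hl, ENNReal.div_mul_cancel hu0 hu] at h2
  calc s ≤ ginv Φ (Φ s) := le_ginv_apply hΦ.mono s
    _ ≤ _ := h2
    _ = C * ginv Φ u * (Φ s / u) := by ring
    _ ≤ _ := by gcongr; exact le_add_self

/-! ### Sources of quasi-convexity, and the Δ₂-condition in terms of inverses -/

/-- In terms of inverses, ∇₂ reads Φ⁻¹(2ku) ≤ k Φ⁻¹(u); iterating it shows that growth of the
argument by (2k)^j costs only k^j. -/
lemma IsNabla2.quasiConvex (h : IsNabla2 Φ) : QuasiConvex Φ := by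
  obtain ⟨k, hk, hn⟩ := h.nabla
  have hk0 : (k : ℝ≥0∞) ≠ 0 := by simpa using (zero_lt_one.trans hk).ne'
  have hstep : ∀ u : ℝ≥0∞, u ≠ 0 → u ≠ ∞ → ginv Φ (2 * k * u) ≤ k * ginv Φ u := by
    intro u hu0 hu
    refine le_mul_ginv_of_forall hu hk0 (by simp) fun t ht => ginv_le_of_lt ?_
    have ht0 : 0 < t := by
      rcases eq_or_ne t 0 with rfl | h0
      · simp [h.isPhi.map_zero] at ht
      · exact pos_iff_ne_zero.2 h0
    have := ht.trans_le (hn t ht0)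
    rwa [mul_comm, ← div_eq_mul_inv, ENNReal.lt_div_iff_mul_lt (by simp [hk0]) (.inl (by finiteness)),
      mul_comm] at this
  have hpow : ∀ (j : ℕ) (u : ℝ≥0∞), u ≠ 0 → u ≠ ∞ →
      ginv Φ ((2 * k) ^ j * u) ≤ k ^ j * ginv Φ u := by
    intro j u hu0 hu
    induction j with
    | zero => simp
    | succ j ih =>
      rw [pow_succ', mul_assoc (2 * (k : ℝ≥0∞)), pow_succ', mul_assoc (k : ℝ≥0∞)]
      refine (hstep _ ?_ ?_).trans (by gcongr)
      · simp [hu0, hk0]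
      · finiteness
  refine ⟨k, hk.le, fun l u hl hu0 hu => ?_⟩
  obtain ⟨j, hj, hj'⟩ := exists_nat_pow_near hl (y := 2 * k)
    (by calc (1 : ℝ≥0) < k := hk
          _ ≤ 2 * k := le_mul_of_one_le_left' (by norm_num))
  have hkl : (k : ℝ≥0∞) ^ j ≤ l := by
    have : k ^ j ≤ l := le_trans (pow_le_pow_left' (le_mul_of_one_le_left' (by norm_num)) j) hj
    exact_mod_cast this
  calc ginv Φ (l * u) ≤ ginv Φ ((2 * k) ^ (j + 1) * u) := by
        refine ginv_mono Φ ?_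
        gcongr
        exact_mod_cast hj'.le
    _ ≤ k ^ (j + 1) * ginv Φ u := hpow _ u hu0 hu
    _ = k * k ^ j * ginv Φ u := by rw [pow_succ']
    _ ≤ _ := by gcongr

/-- Convexity together with Φ(0) = 0 gives Φ(t) ≤ Φ(lt)/l as long as lt stays below the endpoint
`finEnd Φ`. -/
lemma IsYoung.quasiConvex (h : IsYoung Φ) : QuasiConvex Φ := by
  refine ⟨2, by norm_num, fun l u hl hu0 hu => ?_⟩
  have hl0 : l ≠ 0 := (zero_lt_one.trans_le hl).ne'
  refine le_mul_ginv_of_forall hu (by simp [hl0]) (by finiteness) fun t ht => ginv_le_of_lt ?_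
  have hltop : (l : ℝ≥0∞) * u < ∞ := by
    exact ENNReal.mul_lt_top (by simp) (lt_top_iff_ne_top.2 hu)
  rcases lt_or_ge ((l : ℝ≥0∞) * t) (finEnd Φ) with hb | hb
  · have hmem0 : (0 : ℝ≥0∞) ∈ Iio (finEnd Φ) := h.isPhi.finEnd_pos
    have hl1 : l⁻¹ ≤ 1 := inv_le_one_of_one_le₀ hl
    have hc := h.convex.2 (show (l : ℝ≥0∞) * t ∈ Iio (finEnd Φ) from hb) hmem0 zero_le
      zero_le (add_tsub_cancel_of_le hl1)
    rw [smul_zero, add_zero, h.isPhi.map_zero, smul_zero, add_zero] at hc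
    rw [ENNReal.smul_def, ENNReal.smul_def, smul_eq_mul, smul_eq_mul, ← mul_assoc,
      ENNReal.coe_inv hl0, ENNReal.inv_mul_cancel (by simpa using hl0) (by simp), one_mul] at hc
    have h1 := ht.trans_le hc
    rw [mul_comm, ← div_eq_mul_inv, ENNReal.lt_div_iff_mul_lt (by simp [hl0]) (by simp),
      mul_comm] at h1
    refine h1.trans_le (h.isPhi.mono ?_)
    gcongr
    exact le_mul_of_one_le_left' (by norm_num)
  · have htpos : t ≠ 0 := by
      rintro rfl
      simp [h.isPhi.map_zero] at ht
    rcases eq_or_ne t ∞ with htt | htt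
    · rw [htt, ENNReal.mul_top (by simp [hl0]), h.isPhi.apply_top]
      exact hltop
    -- Φ may be finite at the endpoint itself; the constant 2 moves the argument strictly past it,
    -- where Φ = ∞.
    have hlt : finEnd Φ < (2 : ℝ≥0) * l * t := by
      refine hb.trans_lt ?_
      rw [mul_assoc]
      have h0 : (l : ℝ≥0∞) * t ≠ 0 := mul_ne_zero (by simpa using hl0) htpos
      have h1 : (l : ℝ≥0∞) * t ≠ ∞ := by finiteness
      calc (l : ℝ≥0∞) * t < l * t + l * t := ENNReal.lt_add_right h1 h0
        _ = _ := by push_cast; ring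
    obtain ⟨s, hs, hs2⟩ := sInf_lt_iff.1 hlt
    have : Φ ((2 : ℝ≥0) * l * t) = ∞ := top_le_iff.1 ((show Φ s = ∞ from hs) ▸ h.isPhi.mono hs2.le)
    rw [this]
    exact hltop

lemma IsGenYoung.quasiConvex (h : IsGenYoung Φ) : QuasiConvex Φ := by
  obtain ⟨Y, hY, C, hC, hCY⟩ := h.equiv_young
  obtain ⟨D, hD, hq⟩ := hY.quasiConvex
  have hC0 : (C : ℝ≥0∞) ≠ 0 := by simpa using hC.ne'
  have h1 : ∀ u : ℝ≥0∞, u ≠ ∞ → ginv Φ u ≤ C * ginv Y u := fun u hu =>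
    le_mul_ginv_of_forall hu hC0 (by simp) fun t ht => ginv_le_of_lt (ht.trans_le (hCY t).2)
  have h2 : ∀ u : ℝ≥0∞, u ≠ ∞ → ginv Y u ≤ C * ginv Φ u := fun u hu =>
    le_mul_ginv_of_forall hu hC0 (by simp) fun t ht => ginv_le_of_lt (by
      have := (hCY (C * t)).1
      rw [← mul_assoc, ENNReal.inv_mul_cancel hC0 (by simp), one_mul] at this
      exact ht.trans_le this)
  refine ⟨max 1 (C * D * C), le_max_left _ _, fun l u hl hu0 hu => ?_⟩
  have hlu : (l : ℝ≥0∞) * u ≠ ∞ := by finiteness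
  calc ginv Φ (l * u) ≤ C * ginv Y (l * u) := h1 _ hlu
    _ ≤ C * (D * l * (C * ginv Φ u)) := by
      gcongr
      exact (hq l u hl hu0 hu).trans (by gcongr; exact h2 u hu)
    _ = ((C * D * C : ℝ≥0) : ℝ≥0∞) * l * ginv Φ u := by push_cast; ring
    _ ≤ _ := by gcongr; exact le_max_right _ _

/-- Applied to Φ₀, which is only assumed Δ₂. The product Φ⁻¹Φ₀⁻¹ inherits linear growth, and since
Φ⁻¹ increases, the positive finite factor Φ⁻¹(lu) can be cancelled. -/
lemma QuasiConvex.of_comparable (hΨ : QuasiConvex Ψ) (hΦ : IsPhi Φ)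
    (h : Comparable (fun u => ginv Φ u * ginv Φ₀ u) (ginv Ψ)) : QuasiConvex Φ₀ := by
  obtain ⟨D, hD, hq⟩ := hΨ
  obtain ⟨C, hC, h⟩ := h
  have hC0 : (C : ℝ≥0∞) ≠ 0 := by simpa using hC.ne'
  refine ⟨max 1 (C * C * D), le_max_left _ _, fun l u hl hu0 hu => ?_⟩
  have hlu : (l : ℝ≥0∞) * u ≠ ∞ := by finiteness
  have hl1 : (1 : ℝ≥0∞) ≤ l := by exact_mod_cast hl
  have hlu0 : (l : ℝ≥0∞) * u ≠ 0 := mul_ne_zero (by positivity) hu0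
  have h1 : ginv Φ (l * u) * ginv Φ₀ (l * u) ≤
      ginv Φ (l * u) * (((C * C * D : ℝ≥0) : ℝ≥0∞) * l * ginv Φ₀ u) := by
    calc ginv Φ (l * u) * ginv Φ₀ (l * u)
        = C * ((C : ℝ≥0∞)⁻¹ * (ginv Φ (l * u) * ginv Φ₀ (l * u))) := by
          rw [← mul_assoc, ENNReal.mul_inv_cancel hC0 (by simp), one_mul]
      _ ≤ C * ginv Ψ (l * u) := by gcongr; exact (h _).1
      _ ≤ C * (D * l * (C * (ginv Φ u * ginv Φ₀ u))) := by
        gcongr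
        exact (hq l u hl hu0 hu).trans (by gcongr; exact (h u).2)
      _ ≤ C * (D * l * (C * (ginv Φ (l * u) * ginv Φ₀ u))) := by
        gcongr
        exact ginv_mono Φ (le_mul_of_one_le_left' hl1)
      _ = _ := by push_cast; ring
  refine ((ENNReal.mul_le_mul_iff_right (hΦ.ginv_pos hlu0).ne' (hΦ.ginv_lt_top hlu).ne).1 h1).trans ?_
  gcongr
  exact le_max_right _ _

/-- Δ₂ read through inverses. It converts decay of φ into decay of Φ⁻¹(φ), which makes averages over
growing balls converge. -/
lemma IsDelta2.exists_ginv_div_le (h : IsDelta2 Φ) :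
    ∃ C : ℝ≥0, 0 < C ∧ ∀ u : ℝ≥0∞, u ≠ ∞ → ginv Φ (u / C) ≤ 2⁻¹ * ginv Φ u := by
  obtain ⟨C, hC, h2⟩ := h.doubling
  refine ⟨C, hC, fun u hu => le_mul_ginv_of_forall hu (by simp) (by simp) fun t ht => ginv_le_of_lt ?_⟩
  have ht0 : t ≠ 0 := by
    rintro rfl
    simp [h.isPhi.map_zero] at ht
  have := h2 (2⁻¹ * t) (by simp [ht0, pos_iff_ne_zero])
  rw [← mul_assoc, ENNReal.mul_inv_cancel (by simp) (by simp), one_mul] at this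
  refine ENNReal.div_lt_of_lt_mul' (ht.trans_le this)

end Inverse

/-! ### Averages over balls and the growth function -/

section Averages

variable {n : ℕ} {Φ Ψ : ℝ≥0∞ → ℝ≥0∞} {φ : ℝ → ℝ}

/-- Euclidean space of dimension `n`. -/
abbrev Euc (n : ℕ) := EuclideanSpace ℝ (Fin n)

lemma volume_ball_eq (a : Euc n) {r : ℝ} (hr : 0 < r) :
    volume (Metric.ball a r) = ENNReal.ofReal (r ^ n) * volume (Metric.ball (0 : Euc n) 1) := by
  simpa using Measure.addHaar_ball_of_pos (volume : Measure (Euc n)) a hr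

lemma volume_ball_ne_zero (a : Euc n) {r : ℝ} (hr : 0 < r) : volume (Metric.ball a r) ≠ 0 :=
  (Metric.measure_ball_pos _ _ hr).ne'

lemma volume_ball_ne_top (a : Euc n) (r : ℝ) : volume (Metric.ball a r) ≠ ∞ :=
  measure_ball_lt_top.ne

lemma volume_ball_le_mul (a a' : Euc n) {r r' : ℝ} (hr : 0 < r) (hr' : 0 < r') :
    volume (Metric.ball a' r') = ENNReal.ofReal ((r' / r) ^ n) * volume (Metric.ball a r) := by
  rw [volume_ball_eq a hr, volume_ball_eq a' hr', ← mul_assoc, ← ENNReal.ofReal_mul (by positivity),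
    ← mul_pow, div_mul_cancel₀ _ hr.ne']

/-- The average of a nonnegative function over the ball `B(a,r)`. -/
noncomputable def ballAvg (a : Euc n) (r : ℝ) (F : Euc n → ℝ≥0∞) : ℝ≥0∞ :=
  ⨍⁻ x in Metric.ball a r, F x ∂volume

lemma ballAvg_eq (a : Euc n) (r : ℝ) (F : Euc n → ℝ≥0∞) :
    ballAvg a r F = (∫⁻ x in Metric.ball a r, F x) / volume (Metric.ball a r) :=
  setLAverage_eq _ _ _

lemma ballAvg_le_iff (a : Euc n) {r : ℝ} (hr : 0 < r) (F : Euc n → ℝ≥0∞) (u : ℝ≥0∞) :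
    ballAvg a r F ≤ u ↔
      ∫⁻ x in Metric.ball a r, F x ≤ u * volume (Metric.ball a r) := by
  rw [ballAvg_eq, ENNReal.div_le_iff (volume_ball_ne_zero a hr) (volume_ball_ne_top a r)]

lemma setLIntegral_ball_eq (a : Euc n) {r : ℝ} (hr : 0 < r) (F : Euc n → ℝ≥0∞) :
    ∫⁻ x in Metric.ball a r, F x =
      ballAvg a r F * volume (Metric.ball a r) := by
  rw [ballAvg_eq, ENNReal.div_mul_cancel (volume_ball_ne_zero a hr) (volume_ball_ne_top a r)]

lemma ballAvg_mono {a : Euc n} {r : ℝ} {F G : Euc n → ℝ≥0∞}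
    (h : ∀ x ∈ Metric.ball a r, F x ≤ G x) :
    ballAvg a r F ≤ ballAvg a r G := by
  rw [ballAvg_eq, ballAvg_eq]
  gcongr 1
  exact setLIntegral_mono' Metric.isOpen_ball.measurableSet h

lemma ballAvg_const (a : Euc n) {r : ℝ} (hr : 0 < r) (c : ℝ≥0∞) :
    ballAvg a r (fun _ => c) = c := by
  rw [ballAvg_eq, setLIntegral_const,
    ENNReal.mul_div_cancel_right (volume_ball_ne_zero a hr) (volume_ball_ne_top a r)]

lemma ballAvg_const_add (a : Euc n) {r : ℝ} (hr : 0 < r) (c : ℝ≥0∞) (F : Euc n → ℝ≥0∞) :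
    ballAvg a r (fun x => c + F x) = c + ballAvg a r F := by
  rw [ballAvg_eq, lintegral_add_left measurable_const, ENNReal.add_div, ← ballAvg_eq,
    ← ballAvg_eq, ballAvg_const a hr]

lemma ballAvg_add {a : Euc n} {r : ℝ} {F : Euc n → ℝ≥0∞} (hF : AEMeasurable F)
    (G : Euc n → ℝ≥0∞) :
    ballAvg a r (fun x => F x + G x) = ballAvg a r F + ballAvg a r G := by
  rw [ballAvg_eq, lintegral_add_left' hF.restrict, ENNReal.add_div, ← ballAvg_eq,
    ← ballAvg_eq]

lemma ballAvg_const_mul (a : Euc n) (r : ℝ) {c : ℝ≥0∞} (hc : c ≠ ∞) (F : Euc n → ℝ≥0∞) :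
    ballAvg a r (fun x => c * F x) = c * ballAvg a r F := by
  rw [ballAvg_eq, lintegral_const_mul' _ _ hc, ballAvg_eq, mul_div_assoc]

lemma ballAvg_subset {a a' : Euc n} {r r' : ℝ} (hr : 0 < r) (hr' : 0 < r')
    (h : Metric.ball a r ⊆ Metric.ball a' r') (F : Euc n → ℝ≥0∞) :
    ballAvg a r F ≤
      ENNReal.ofReal ((r' / r) ^ n) * ballAvg a' r' F := by
  rw [ballAvg_le_iff a hr, mul_right_comm, ← volume_ball_le_mul a a' hr hr', mul_comm,
    ← setLIntegral_ball_eq a' hr']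
  exact lintegral_mono_set h

/-- The modular inequality `⨍_B Φ(F) ≤ φ(r)` on all balls `B = B(a,r)`. -/
def ModularLE (Φ : ℝ≥0∞ → ℝ≥0∞) (φ : ℝ → ℝ) (F : Euc n → ℝ≥0∞) : Prop :=
  ∀ (a : Euc n) (r : ℝ), 0 < r → ballAvg a r (fun x => Φ (F x)) ≤ ENNReal.ofReal (φ r)

lemma ModularLE.mono (hΦ : Monotone Φ) {F G : Euc n → ℝ≥0∞} (h : ModularLE Φ φ G)
    (hFG : ∀ x, F x ≤ G x) : ModularLE Φ φ F := fun a r hr =>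
  (ballAvg_mono fun x _ => hΦ (hFG x)).trans (h a r hr)

/-- A bounded factor on the right-hand side of the modular inequality is absorbed by a dilation. -/
lemma QuasiConvex.exists_modularLE_div (hΦ : IsPhi Φ) (h : QuasiConvex Φ) {l : ℝ≥0} (hl : 1 ≤ l) :
    ∃ D : ℝ≥0, 1 ≤ D ∧ ∀ (φ : ℝ → ℝ) (F : Euc n → ℝ≥0∞),
      (∀ (a : Euc n) (r : ℝ), 0 < r →
        ballAvg a r (fun x => Φ (F x)) ≤ l * ENNReal.ofReal (φ r)) →
      ModularLE Φ φ (fun x => F x / D) := by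
  obtain ⟨D, hD, h⟩ := h.exists_apply_div_le hΦ hl
  have hl0 : (l : ℝ≥0∞) ≠ 0 := by simpa using (zero_lt_one.trans_le hl).ne'
  refine ⟨D, hD, fun φ F hF a r hr => ?_⟩
  calc ballAvg a r (fun x => Φ (F x / D))
      ≤ ballAvg a r (fun x => (l : ℝ≥0∞)⁻¹ * Φ (F x)) :=
        ballAvg_mono fun x _ => (h _).trans_eq (by rw [ENNReal.div_eq_inv_mul])
    _ = (l : ℝ≥0∞)⁻¹ * ballAvg a r (fun x => Φ (F x)) :=
        ballAvg_const_mul _ _ (by simpa using hl0) _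
    _ ≤ (l : ℝ≥0∞)⁻¹ * (l * ENNReal.ofReal (φ r)) := by gcongr; exact hF a r hr
    _ = ENNReal.ofReal (φ r) := by
        rw [← mul_assoc, ENNReal.inv_mul_cancel hl0 (by simp), one_mul]

/-- Jensen's inequality for quasi-convex functions. -/
lemma QuasiConvex.exists_ballAvg_le (hΦ : IsPhi Φ) (h : QuasiConvex Φ) :
    ∃ C : ℝ≥0, 1 ≤ C ∧ ∀ (a : Euc n) (r : ℝ) (u : ℝ≥0∞) (F : Euc n → ℝ≥0∞), 0 < r → u ≠ 0 →
      u ≠ ∞ → ballAvg a r (fun x => Φ (F x)) ≤ u →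
      ballAvg a r F ≤ C * ginv Φ u := by
  obtain ⟨C, hC, h⟩ := h.exists_le_ginv_mul hΦ
  refine ⟨C * 2, one_le_mul hC (by norm_num), fun a r u F hr hu0 hu hF => ?_⟩
  have hg := (hΦ.ginv_lt_top hu).ne
  calc ballAvg a r F
      ≤ ballAvg a r (fun x => C * ginv Φ u * (1 + u⁻¹ * Φ (F x))) :=
        ballAvg_mono fun x _ => (h u (F x) hu0 hu).trans_eq (by rw [ENNReal.div_eq_inv_mul])
    _ = C * ginv Φ u * (1 + u⁻¹ * ballAvg a r fun x => Φ (F x)) := by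
        rw [ballAvg_const_mul _ _ (by finiteness), ballAvg_const_add _ hr,
          ballAvg_const_mul _ _ (by simpa using hu0)]
    _ ≤ C * ginv Φ u * (1 + u⁻¹ * u) := by gcongr
    _ = ((C * 2 : ℝ≥0) : ℝ≥0∞) * ginv Φ u := by
        rw [ENNReal.inv_mul_cancel hu0 hu]; push_cast; rw [one_add_one_eq_two]; ring

/-! ### Doubling and geometric decay of φ -/

lemma IsGdec.ofReal_ne_zero (h : IsGdec n φ) {r : ℝ} (hr : 0 < r) : ENNReal.ofReal (φ r) ≠ 0 := by
  simpa using h.pos r hr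

/-- For s > r this is almost decrease; for r/l ≤ s < r, almost increase of φ(r) rⁿ costs a factor
(r/s)ⁿ ≤ lⁿ. -/
lemma IsGdec.exists_le_mul (h : IsGdec n φ) {l : ℝ} (hl : 1 ≤ l) :
    ∃ C : ℝ≥0, 1 ≤ C ∧ ∀ r s : ℝ, 0 < r → 0 < s → r ≤ l * s →
      ENNReal.ofReal (φ s) ≤ C * ENNReal.ofReal (φ r) := by
  obtain ⟨C, hC, h2⟩ := h.almost
  have hln : 1 ≤ l ^ n := one_le_pow₀ hl
  refine ⟨max 1 (C * l ^ n).toNNReal, le_max_left _ _, fun r s hr hs hrs => ?_⟩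
  have hr' := h.pos r hr
  have key : φ s ≤ max 1 (C * l ^ n) * φ r := by
    rcases lt_trichotomy r s with hlt | rfl | hlt
    · calc φ s ≤ C * φ r := (h2 r s hr hlt).1
        _ ≤ (C * l ^ n) * φ r := by gcongr; exact le_mul_of_one_le_right hC.le hln
        _ ≤ _ := by gcongr; exact le_max_right _ _
    · exact le_mul_of_one_le_left hr'.le (le_max_left _ _)
    · have h3 := (h2 s r hs hlt).2
      have hsn : 0 < s ^ n := by positivity
      have h4 : φ s * s ^ n ≤ (C * l ^ n * φ r) * s ^ n := by
        calc φ s * s ^ n ≤ C * (φ r * r ^ n) := h3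
          _ ≤ C * (φ r * (l * s) ^ n) := by gcongr
          _ = _ := by rw [mul_pow]; ring
      calc φ s ≤ C * l ^ n * φ r := le_of_mul_le_mul_right h4 hsn
        _ ≤ _ := by gcongr; exact le_max_right _ _
  calc ENNReal.ofReal (φ s) ≤ ENNReal.ofReal (max 1 (C * l ^ n) * φ r) :=
        ENNReal.ofReal_le_ofReal key
    _ = ENNReal.ofReal (max 1 (C * l ^ n)) * ENNReal.ofReal (φ r) :=
        ENNReal.ofReal_mul (by positivity)
    _ = _ := by
        congr 1
        rw [ENNReal.ofReal, Monotone.map_max (fun _ _ => Real.toNNReal_le_toNNReal), Real.toNNReal_one]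

lemma QuasiConvex.exists_ginv_le (hΦ : QuasiConvex Φ) (h : IsGdec n φ) {l : ℝ} (hl : 1 ≤ l) :
    ∃ C : ℝ≥0, 1 ≤ C ∧ ∀ r s : ℝ, 0 < r → 0 < s → r ≤ l * s →
      ginv Φ (ENNReal.ofReal (φ s)) ≤ C * ginv Φ (ENNReal.ofReal (φ r)) := by
  obtain ⟨C, hC, h1⟩ := h.exists_le_mul hl
  obtain ⟨D, hD, h2⟩ := hΦ
  refine ⟨D * C, one_le_mul hD hC, fun r s hr hs hrs => ?_⟩
  calc ginv Φ (ENNReal.ofReal (φ s)) ≤ ginv Φ (C * ENNReal.ofReal (φ r)) :=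
        ginv_mono Φ (h1 r s hr hs hrs)
    _ ≤ D * C * ginv Φ (ENNReal.ofReal (φ r)) :=
        h2 C _ hC (h.ofReal_ne_zero hr) ENNReal.ofReal_ne_top
    _ = _ := by push_cast; rfl

lemma lintegral_Ioc_one_div {a b : ℝ} (ha : 0 < a) (hab : a ≤ b) :
    ∫⁻ t in Ioc a b, ENNReal.ofReal (1 / t) = ENNReal.ofReal (Real.log (b / a)) := by
  rw [← integral_one_div_of_pos ha (ha.trans_le hab), intervalIntegral.integral_of_le hab,
    ofReal_integral_eq_lintegral_ofReal]
  · have : IntervalIntegrable (fun t : ℝ => 1 / t) volume a b := by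
      refine intervalIntegral.intervalIntegrable_one_div (fun x hx => ?_) continuousOn_id
      rw [uIcc_of_le hab] at hx
      exact (ha.trans_le hx.1).ne'
    exact (intervalIntegrable_iff_integrableOn_Ioc_of_le hab).1 this
  · refine (ae_restrict_iff' measurableSet_Ioc).2 (ae_of_all _ fun t ht => ?_)
    exact one_div_nonneg.2 (ha.trans ht.1).le

/-- On [r, R] the function φ is almost bounded below by φ(R), so φ(R) log(R/r) ≲ ∫_r^∞ φ(t)/t dt ≲
φ(r). With R = 2^m r the logarithm is m log 2, and `m` is taken large, uniformly in `r`. -/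
lemma IsGdec.exists_pow_two_decay (h : IsGdec n φ) (hint : IntegralCondition φ) {ε : ℝ≥0}
    (hε : 0 < ε) : ∃ m : ℕ, 0 < m ∧ ∀ r : ℝ, 0 < r →
      ENNReal.ofReal (φ (2 ^ m * r)) ≤ ε * ENNReal.ofReal (φ r) := by
  obtain ⟨C, hC, h1⟩ := h.exists_le_mul le_rfl
  obtain ⟨D, hD, h2⟩ := hint
  obtain ⟨m, hm⟩ := exists_nat_gt (max 0 (C * D / ε / Real.log 2 : ℝ))
  have hm0 : 0 < m := by exact_mod_cast (le_max_left _ _).trans_lt hm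
  refine ⟨m, hm0, fun r hr => ?_⟩
  have hlog : 0 < Real.log 2 := Real.log_pos (by norm_num)
  have hC0 : 0 < C := zero_lt_one.trans_le hC
  have hmul : (C * D : ℝ) ≤ ε * (m * Real.log 2) := by
    have h3 := (le_max_right _ _).trans_lt hm
    rw [div_lt_iff₀ hlog, div_lt_iff₀ (by exact_mod_cast hε)] at h3
    linarith
  set R := 2 ^ m * r
  have hR : r ≤ R := le_mul_of_one_le_left hr.le (one_le_pow₀ (by norm_num))
  have hR0 : 0 < R := hr.trans_le hR
  set u := ENNReal.ofReal (φ R)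
  have h3 : u * ENNReal.ofReal (m * Real.log 2) ≤ C * (D * ENNReal.ofReal (φ r)) := by
    calc u * ENNReal.ofReal (m * Real.log 2)
        = u * ∫⁻ t in Ioc r R, ENNReal.ofReal (1 / t) := by
          rw [lintegral_Ioc_one_div hr hR, mul_div_cancel_right₀ _ hr.ne', Real.log_pow]
      _ = ∫⁻ t in Ioc r R, u * ENNReal.ofReal (1 / t) := by
          rw [lintegral_const_mul' _ _ ENNReal.ofReal_ne_top]
      _ ≤ ∫⁻ t in Ioc r R, C * ENNReal.ofReal (φ t / t) := by
          refine setLIntegral_mono' measurableSet_Ioc fun t ht => ?_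
          have ht0 : 0 < t := hr.trans ht.1
          rw [div_eq_mul_one_div (φ t), ENNReal.ofReal_mul (h.pos t ht0).le, ← mul_assoc]
          gcongr
          exact h1 t R ht0 hR0 (by simpa using ht.2)
      _ = C * ∫⁻ t in Ioc r R, ENNReal.ofReal (φ t / t) := lintegral_const_mul' _ _ (by simp)
      _ ≤ C * ∫⁻ t in Ioi r, ENNReal.ofReal (φ t / t) := by
          gcongr
          exact Ioc_subset_Ioi_self
      _ ≤ _ := by gcongr; exact h2 r hr
  have h4 : ENNReal.ofReal (C * D) ≤ ε * ENNReal.ofReal (m * Real.log 2) := by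
    rw [← ENNReal.ofReal_coe_nnreal (p := ε), ← ENNReal.ofReal_mul (by positivity)]
    exact ENNReal.ofReal_le_ofReal hmul
  rw [ENNReal.ofReal_mul (by positivity), ENNReal.ofReal_coe_nnreal, ENNReal.ofReal_coe_nnreal] at h4
  set A := ENNReal.ofReal (m * Real.log 2)
  have hA0 : A ≠ 0 := by
    have : (0 : ℝ) < m * Real.log 2 := by positivity
    exact (ENNReal.ofReal_pos.2 this).ne'
  refine (ENNReal.mul_le_mul_iff_left hA0 ENNReal.ofReal_ne_top).1 (h3.trans ?_)
  calc C * (D * ENNReal.ofReal (φ r)) = (C * D) * ENNReal.ofReal (φ r) := by ring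
    _ ≤ (ε * A) * ENNReal.ofReal (φ r) := by gcongr
    _ = _ := by ring

end Averages

/-! ### The Hardy-Littlewood maximal function -/

section Maximal

variable {n : ℕ} {Φ : ℝ≥0∞ → ℝ≥0∞} {φ : ℝ → ℝ}

/-- The (centred) Hardy-Littlewood maximal function. -/
noncomputable def maximal (F : Euc n → ℝ≥0∞) (x : Euc n) : ℝ≥0∞ :=
  ⨆ (r : ℝ) (_ : 0 < r), ballAvg x r F

lemma ballAvg_le_maximal (F : Euc n → ℝ≥0∞) (x : Euc n) {r : ℝ} (hr : 0 < r) :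
    ballAvg x r F ≤ maximal F x := le_iSup₂ (f := fun r (_ : 0 < r) => ballAvg x r F) r hr

lemma maximal_le {F : Euc n → ℝ≥0∞} {x : Euc n} {c : ℝ≥0∞}
    (h : ∀ r, 0 < r → ballAvg x r F ≤ c) : maximal F x ≤ c := iSup₂_le h

/-- Weak type (1,1) from the Vitali covering lemma, 5ⁿ being the volume ratio of the enlarged balls.
Only outer measures occur, so no measurability is required. -/
lemma volume_lt_maximal_le (hn : 1 ≤ n) (F : Euc n → ℝ≥0∞) {t : ℝ≥0∞} (ht0 : t ≠ 0)
    (ht : t ≠ ∞) :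
    volume {x | t < maximal F x} ≤ ENNReal.ofReal (5 ^ n) / t * ∫⁻ x, F x := by
  rcases eq_or_ne (∫⁻ x, F x) ∞ with hI | hI
  · rw [hI, ENNReal.mul_top]
    · exact le_top
    · exact (ENNReal.div_pos (by positivity) ht).ne'
  have hex : ∀ x ∈ {x | t < maximal F x}, ∃ r, 0 < r ∧ t < ballAvg x r F := by
    intro x hx
    obtain ⟨r, hr⟩ := lt_iSup_iff.1 (show t < maximal F x from hx)
    obtain ⟨hr0, hr⟩ := lt_iSup_iff.1 hr
    exact ⟨r, hr0, hr⟩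
  choose! R hR0 hR using hex
  set S := {x | t < maximal F x}
  have hball : ∀ x ∈ S, volume (Metric.ball x (R x)) ≤
      t⁻¹ * ∫⁻ y in Metric.ball x (R x), F y := by
    intro x hx
    rw [setLIntegral_ball_eq x (hR0 x hx), ← mul_assoc]
    refine le_mul_of_one_le_left' ?_
    rw [mul_comm, ← div_eq_mul_inv]
    exact (ENNReal.le_div_iff_mul_le (.inl ht0) (.inl ht)).2 (by simpa using (hR x hx).le)
  set V := volume (Metric.ball (0 : Euc n) 1)
  have hV0 : V ≠ 0 := volume_ball_ne_zero 0 one_pos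
  have hVt : V ≠ ∞ := volume_ball_ne_top 0 1
  set X := t⁻¹ * (∫⁻ x, F x) / V
  have hX : X ≠ ∞ := ENNReal.div_ne_top (ENNReal.mul_ne_top (by simpa using ht0) hI) hV0
  -- Vitali's lemma needs bounded radii. A selected ball has volume at most t⁻¹∫F, so R(x)ⁿ ≤ X, and
  -- R(x) ≤ R(x)ⁿ once R(x) > 1 because n ≥ 1.
  have hbdd : ∀ x ∈ S, R x ≤ max 1 X.toReal := by
    intro x hx
    by_contra! hc
    have h1 : 1 < R x := (le_max_left _ _).trans_lt hc
    have h2 : X.toReal < R x := (le_max_right _ _).trans_lt hc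
    have h3 : ENNReal.ofReal (R x ^ n) ≤ X := by
      rw [ENNReal.le_div_iff_mul_le (.inl hV0) (.inl hVt), ← volume_ball_eq x (hR0 x hx)]
      refine (hball x hx).trans ?_
      gcongr
      exact Measure.restrict_le_self
    have h4 : R x ^ n ≤ X.toReal := (ENNReal.ofReal_le_iff_le_toReal hX).1 h3
    exact absurd (h4.trans_lt h2) (not_lt.2 (le_self_pow₀ h1.le (by omega)))
  obtain ⟨u, huS, hdisj, hcov⟩ := Vitali.exists_disjoint_subfamily_covering_enlargement_ball
    S (fun x => x) R _ hbdd 5 (by norm_num)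
  have hcount : u.Countable := hdisj.countable_of_isOpen (fun _ _ => Metric.isOpen_ball)
    fun x hx => Metric.nonempty_ball.2 (hR0 x (huS hx))
  have hsub : S ⊆ ⋃ b ∈ u, Metric.ball b (5 * R b) := fun x hx => by
    obtain ⟨b, hb, hsub⟩ := hcov x hx
    exact mem_biUnion hb (hsub (Metric.mem_ball_self (hR0 x hx)))
  calc volume S ≤ ∑' b : u, volume (Metric.ball (b : Euc n) (5 * R b)) :=
        (measure_mono hsub).trans (measure_biUnion_le _ hcount _)
    _ ≤ ∑' b : u, ENNReal.ofReal (5 ^ n) / t * ∫⁻ y in Metric.ball (b : Euc n) (R b), F y := by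
        refine ENNReal.tsum_le_tsum fun b => ?_
        have hb0 := hR0 b (huS b.2)
        rw [volume_ball_le_mul (b : Euc n) b hb0 (by positivity : 0 < 5 * R b), mul_div_cancel_right₀ _ hb0.ne',
          div_eq_mul_inv, mul_assoc]
        gcongr
        exact hball b (huS b.2)
    _ = ENNReal.ofReal (5 ^ n) / t * ∫⁻ y in ⋃ b ∈ u, Metric.ball b (R b), F y := by
        rw [ENNReal.tsum_mul_left, lintegral_biUnion hcount
          (fun _ _ => Metric.isOpen_ball.measurableSet) hdisj]
    _ ≤ _ := by gcongr; exact Measure.restrict_le_self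

/-- F is at most t plus its part above height t, and the constant t adds at most t to the maximal
function. Keeping only {F > t} on the right makes the sum over heights converge. -/
lemma volume_two_mul_lt_maximal_le (hn : 1 ≤ n) (F : Euc n → ℝ≥0∞) {t : ℝ≥0∞} (ht0 : t ≠ 0)
    (ht : t ≠ ∞) :
    volume {x | 2 * t < maximal F x} ≤
      ENNReal.ofReal (5 ^ n) / t * ∫⁻ x, {x | t < F x}.indicator F x := by
  refine le_trans (measure_mono fun x hx => ?_) (volume_lt_maximal_le hn _ ht0 ht)
  have h1 : maximal F x ≤ t + maximal ({x | t < F x}.indicator F) x := maximal_le fun r hr => by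
    calc ballAvg x r F ≤ ballAvg x r (fun y => t + {x | t < F x}.indicator F y) :=
          ballAvg_mono fun y _ => by
            by_cases hy : t < F y
            · rw [indicator_of_mem (by exact hy)]; exact le_add_self
            · exact (not_lt.1 hy).trans le_self_add
      _ = t + ballAvg x r ({x | t < F x}.indicator F) := ballAvg_const_add x hr t _
      _ ≤ _ := by gcongr; exact ballAvg_le_maximal _ _ hr
  have h2 : t + t < t + maximal ({x | t < F x}.indicator F) x := by
    rw [← two_mul]; exact lt_of_lt_of_le hx h1
  exact (ENNReal.add_lt_add_iff_left ht).1 h2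

/-- The modular inequality for the maximal function under the `∇₂`-condition. -/
lemma IsNabla2.exists_lintegral_maximal_le (hn : 1 ≤ n) (h : IsNabla2 Φ) :
    ∃ C : ℝ≥0, 1 ≤ C ∧ ∀ F : Euc n → ℝ≥0∞, AEMeasurable F →
      ∫⁻ x, Φ (maximal F x) ≤ C * ∫⁻ x, Φ (C * F x) := by
  obtain ⟨k, hk, hnab⟩ := h.nabla
  have hΦ := h.isPhi
  have hk0 : (k : ℝ≥0∞) ≠ 0 := by simpa using (zero_lt_one.trans hk).ne'
  have hk1 : (1 : ℝ≥0∞) < k := by exact_mod_cast hk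
  have hkt : (k : ℝ≥0∞) ≠ ∞ := by simp
  have hpow0 : ∀ j : ℤ, (k : ℝ≥0∞) ^ j ≠ 0 := fun j => (ENNReal.zpow_pos hk0 hkt j).ne'
  have hpowt : ∀ j : ℤ, (k : ℝ≥0∞) ^ j ≠ ∞ := fun j => (ENNReal.zpow_lt_top hk0 hkt j).ne
  have hsucc : ∀ j : ℤ, (k : ℝ≥0∞) ^ (j + 1) = k * k ^ j := fun j => by
    rw [ENNReal.zpow_add hk0 hkt, zpow_one, mul_comm]
  have hnear : ∀ y : ℝ≥0∞, y ≠ 0 → y ≠ ∞ → ∃ j : ℤ, (k : ℝ≥0∞) ^ j < y ∧ y ≤ k ^ (j + 1) := by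
    intro y hy0 hy
    obtain ⟨j, hj⟩ := ENNReal.exists_mem_Ioc_zpow hy0 hy hk1 hkt
    exact ⟨j, hj⟩
  have hdec : ∀ (i : ℕ) (j : ℤ), Φ (k ^ (j - i)) ≤ (2 * (k : ℝ≥0∞))⁻¹ ^ i * Φ (k ^ j) := by
    intro i j
    induction i with
    | zero => simp
    | succ i ih =>
      refine (hnab (k ^ (j - (i + 1 : ℕ))) (pos_iff_ne_zero.2 (hpow0 _))).trans ?_
      rw [← hsucc, pow_succ', mul_assoc,
        show j - ((i + 1 : ℕ) : ℤ) + 1 = j - i by push_cast; ring]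
      gcongr
  -- Discrete layer-cake bound on the grid k^j: the cell containing `y` already dominates. At y = ∞
  -- the terms Φ(k^(j+1)) are unbounded, so the sum is infinite.
  have hlow : ∀ y, Φ y ≤ ∑' j : ℤ, {y : ℝ≥0∞ | k ^ j < y}.indicator (fun _ => Φ (k ^ (j + 1))) y := by
    intro y
    rcases eq_or_ne y 0 with rfl | hy0
    · simp [hΦ.map_zero]
    rcases eq_or_ne y ∞ with rfl | hy
    · set w := ∑' j : ℤ, {y : ℝ≥0∞ | k ^ j < y}.indicator (fun _ => Φ (k ^ (j + 1))) ∞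
      by_contra! hc
      have hw : w ≠ ∞ := ne_top_of_lt hc
      have hg := hΦ.ginv_lt_top hw
      obtain ⟨j, -, hj⟩ := hnear (max 1 (ginv Φ w)) (by positivity) (by finiteness)
      have h1 : ginv Φ w < k ^ (j + 1 + 1) := by
        refine (le_max_right _ _).trans_lt (hj.trans_lt ?_)
        rw [hsucc (j + 1)]
        simpa using (ENNReal.mul_lt_mul_iff_left (hpow0 (j + 1)) (hpowt (j + 1))).2 hk1
      refine absurd (lt_apply_of_ginv_lt hΦ.mono h1) (not_lt.2 ?_)
      refine (le_of_eq ?_).trans (ENNReal.le_tsum (j + 1))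
      rw [indicator_of_mem]
      exact (hpowt _).lt_top
    · obtain ⟨j, hj, hj'⟩ := hnear y hy0 hy
      refine (hΦ.mono hj').trans ((le_of_eq ?_).trans (ENNReal.le_tsum j))
      rw [indicator_of_mem (by exact hj)]
  set A := ENNReal.ofReal (5 ^ n)
  -- Let J be the last index with k^J < 2y. At the index J - i, iterated ∇₂ gains (2k)^(-i), while
  -- y/(k^j/2) loses k^(i+1). What survives is 2^(-i), which is summable: this is where 2k, rather
  -- than k, in ∇₂ is decisive.
  have hup : ∀ y : ℝ≥0∞, ∑' j : ℤ, Φ (k ^ (j + 1)) * (A / (k ^ j / 2) *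
      {y : ℝ≥0∞ | k ^ j / 2 < y}.indicator (fun y => y) y) ≤ 2 * k * A * Φ (2 * k * y) := by
    intro y
    have hA0 : A ≠ 0 := (ENNReal.ofReal_pos.2 (by positivity)).ne'
    rcases eq_or_ne y ∞ with rfl | hy
    · rw [ENNReal.mul_top (by simp [hk0]), hΦ.apply_top, ENNReal.mul_top (by simp [hk0, hA0])]
      exact le_top
    rcases eq_or_ne y 0 with rfl | hy0
    · simp
    obtain ⟨J, hJ, hJ'⟩ := hnear (2 * y) (by simp [hy0]) (by finiteness)
    have hinj : Function.Injective fun i : ℕ => J - (i : ℤ) := fun a b hab => by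
      simp only at hab; omega
    rw [← hinj.tsum_eq]
    · calc ∑' i : ℕ, Φ (k ^ (J - i + 1)) * (A / (k ^ (J - (i : ℤ)) / 2) *
            {y : ℝ≥0∞ | k ^ (J - (i : ℤ)) / 2 < y}.indicator (fun y => y) y)
          ≤ ∑' i : ℕ, (2 : ℝ≥0∞)⁻¹ ^ i * (k * A * Φ (2 * k * y)) := by
            refine ENNReal.tsum_le_tsum fun i => ?_
            set c := (k : ℝ≥0∞) ^ (J - (i : ℤ)) / 2
            have hc0 : c ≠ 0 := (ENNReal.half_pos (hpow0 _)).ne'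
            have hct : c ≠ ∞ := ENNReal.div_ne_top (hpowt _) (by simp)
            have hyc : y ≤ k ^ (i + 1) * c := by
              have h2y : y = 2 * y / 2 := by
                rw [mul_comm, ENNReal.mul_div_cancel_right (by simp) (by simp)]
              rw [h2y, ← mul_div_assoc, ← zpow_natCast, ← ENNReal.zpow_add hk0 hkt]
              gcongr
              convert hJ' using 2
              push_cast; ring
            have h1 : {y : ℝ≥0∞ | c < y}.indicator (fun y => y) y ≤ k ^ (i + 1) * c :=
              (indicator_le_self _ _ _).trans hyc
            have h2 : Φ (k ^ (J - i + 1)) ≤ (2 * (k : ℝ≥0∞))⁻¹ ^ i * Φ (2 * k * y) := by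
              have h3 := hdec i (J + 1)
              rw [show J - (i : ℤ) + 1 = J + 1 - i by ring]
              refine h3.trans ?_
              gcongr
              refine hΦ.mono ?_
              rw [hsucc, mul_right_comm, mul_comm]
              gcongr
            calc Φ (k ^ (J - i + 1)) * (A / c * {y : ℝ≥0∞ | c < y}.indicator (fun y => y) y)
                ≤ ((2 * (k : ℝ≥0∞))⁻¹ ^ i * Φ (2 * k * y)) * (A / c * (k ^ (i + 1) * c)) := by
                  gcongr
              _ = 2⁻¹ ^ i * (k * A * Φ (2 * k * y)) * ((k : ℝ≥0∞)⁻¹ * k) ^ i * (c⁻¹ * c) := by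
                  rw [ENNReal.mul_inv (by simp) (by simp), div_eq_mul_inv, mul_pow, mul_pow]
                  ring
              _ = _ := by
                  rw [ENNReal.inv_mul_cancel hk0 hkt, ENNReal.inv_mul_cancel hc0 hct]; simp
        _ = 2 * k * A * Φ (2 * k * y) := by
            rw [ENNReal.tsum_mul_right, ENNReal.tsum_geometric, ENNReal.one_sub_inv_two, inv_inv]
            ring
    · intro j hj
      have hjy : (k : ℝ≥0∞) ^ j / 2 < y := by
        by_contra hc
        simp [hc] at hj
      have hjy' : (k : ℝ≥0∞) ^ j < k ^ (J + 1) := by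
        refine lt_of_lt_of_le ?_ hJ'
        rwa [ENNReal.div_lt_iff (by simp) (by simp), mul_comm] at hjy
      have hjJ : j < J + 1 := by
        by_contra! hc
        exact absurd hjy' (not_lt.2 (ENNReal.zpow_le_of_le hk1.le hc))
      exact ⟨(J - j).toNat, by simp only; omega⟩
  refine ⟨max (2 * k) (2 * k * (5 ^ n)), ?_, fun F hF => ?_⟩
  · refine le_max_of_le_left ?_
    exact one_le_mul (by norm_num) hk.le
  calc ∫⁻ x, Φ (maximal F x)
      ≤ ∫⁻ x, ∑' j : ℤ, (toMeasurable volume {x | k ^ j < maximal F x}).indicator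
          (fun _ => Φ (k ^ (j + 1))) x := by
        -- Measurable hulls have the same measure as the superlevel sets, whose own measurability is
        -- then irrelevant.
        refine lintegral_mono fun x => (hlow _).trans (ENNReal.tsum_le_tsum fun j => ?_)
        by_cases hx : (k : ℝ≥0∞) ^ j < maximal F x
        · rw [indicator_of_mem (by exact hx),
            indicator_of_mem (subset_toMeasurable _ {x | k ^ j < maximal F x} hx)]
        · rw [indicator_of_notMem (by exact hx)]; exact zero_le
    _ = ∑' j : ℤ, Φ (k ^ (j + 1)) * volume {x | k ^ j < maximal F x} := by
        rw [lintegral_tsum fun j =>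
          (measurable_const.indicator (measurableSet_toMeasurable _ _)).aemeasurable]
        congr with j
        rw [lintegral_indicator_const (measurableSet_toMeasurable _ _), measure_toMeasurable]
    _ ≤ ∑' j : ℤ, Φ (k ^ (j + 1)) * (A / (k ^ j / 2) *
          ∫⁻ x, {x | k ^ j / 2 < F x}.indicator F x) := by
        refine ENNReal.tsum_le_tsum fun j => ?_
        gcongr
        have := volume_two_mul_lt_maximal_le hn F (t := k ^ j / 2)
          (ENNReal.half_pos (hpow0 j)).ne' (ENNReal.div_ne_top (hpowt j) (by simp))
        rwa [ENNReal.mul_div_cancel (by simp) (by simp)] at this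
    _ = ∫⁻ x, ∑' j : ℤ, Φ (k ^ (j + 1)) * (A / (k ^ j / 2) *
          {x | k ^ j / 2 < F x}.indicator F x) := by
        have hm : ∀ j : ℤ, AEMeasurable ({x | k ^ j / 2 < F x}.indicator F) := fun j =>
          hF.indicator₀ (nullMeasurableSet_lt aemeasurable_const hF)
        rw [lintegral_tsum fun j => ((hm j).const_mul _).const_mul _]
        congr with j
        rw [lintegral_const_mul'' _ ((hm j).const_mul _), lintegral_const_mul'' _ (hm j)]
    _ ≤ ∫⁻ x, 2 * k * A * Φ (2 * k * F x) := by
        refine lintegral_mono fun x => ?_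
        exact hup (F x)
    _ = 2 * k * A * ∫⁻ x, Φ (2 * k * F x) := lintegral_const_mul' _ _ (by finiteness)
    _ ≤ _ := by
        have hA : A = ((5 ^ n : ℝ≥0) : ℝ≥0∞) := by simp [A, ENNReal.ofReal_pow]
        gcongr
        · rw [hA]
          exact_mod_cast le_max_right (2 * k) (2 * k * 5 ^ n)
        · refine hΦ.mono ?_
          gcongr
          exact_mod_cast le_max_left (2 * k) (2 * k * 5 ^ n)

lemma maximal_add_le {F : Euc n → ℝ≥0∞} (hF : AEMeasurable F) (G : Euc n → ℝ≥0∞) (x : Euc n) :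
    maximal (fun y => F y + G y) x ≤ maximal F x + maximal G x := maximal_le fun r hr => by
  rw [ballAvg_add hF]
  exact add_le_add (ballAvg_le_maximal _ _ hr) (ballAvg_le_maximal _ _ hr)

lemma maximal_le_mul_maximal_div (F : Euc n → ℝ≥0∞) {c : ℝ≥0∞} (hc0 : c ≠ 0) (hc : c ≠ ∞)
    (x : Euc n) : maximal F x ≤ c * maximal (fun y => F y / c) x := maximal_le fun r hr => by
  calc ballAvg x r F = c * ballAvg x r (fun y => F y / c) := by
        rw [← ballAvg_const_mul _ _ hc]
        congr with y
        rw [ENNReal.mul_div_cancel hc0 hc]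
    _ ≤ _ := by gcongr; exact ballAvg_le_maximal _ _ hr

/-- The maximal function of a function supported outside `B(a,3r)` on the ball `B(a,r)`. -/
lemma maximal_indicator_compl_ball_le {a x : Euc n} {r : ℝ} (hr : 0 < r)
    (hx : x ∈ Metric.ball a r) (F : Euc n → ℝ≥0∞) {c : ℝ≥0∞}
    (h : ∀ s, r < s → ballAvg x s F ≤ c) :
    maximal ((Metric.ball a (3 * r))ᶜ.indicator F) x ≤ c := maximal_le fun s hs => by
  rcases lt_or_ge r s with hrs | hrs
  · exact (ballAvg_mono fun y _ => indicator_le_self _ _ _).trans (h s hrs)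
  -- For s ≤ r the ball B(x,s) lies inside B(a,2r) and misses the support.
  · refine le_trans ?_ (zero_le (a := c))
    rw [← ballAvg_const x hs 0]
    refine ballAvg_mono fun y hy => ?_
    rw [indicator_of_notMem]
    rw [notMem_compl_iff, Metric.mem_ball]
    rw [Metric.mem_ball] at hx hy
    linarith [dist_triangle y x a]

/-- The maximal function preserves the modular inequality, up to a dilation. -/
lemma IsNabla2.exists_modularLE_maximal (hn : 1 ≤ n) (h : IsNabla2 Φ) (hφ : IsGdec n φ) :
    ∃ L : ℝ≥0, 1 ≤ L ∧ ∀ F : Euc n → ℝ≥0∞, AEMeasurable F → ModularLE Φ φ F →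
      ModularLE Φ φ (fun x => maximal F x / L) := by
  have hΦ := h.isPhi
  have hq := h.quasiConvex
  obtain ⟨C₁, hC₁, hstrong⟩ := h.exists_lintegral_maximal_le (n := n) hn
  obtain ⟨C₂, hC₂, hjen⟩ := hq.exists_ballAvg_le (n := n) hΦ
  obtain ⟨C₃, hC₃, hginv⟩ := hq.exists_ginv_le hφ le_rfl
  obtain ⟨C₄, hC₄, hdec⟩ := hφ.exists_le_mul le_rfl
  have hl : (1 : ℝ≥0) ≤ C₁ * (C₄ * 3 ^ n) + 1 := le_add_self
  obtain ⟨D, hD, habs⟩ := hq.exists_modularLE_div (n := n) hΦ hl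
  -- Large enough for both parts: C₁ is the dilation in the global inequality for the near part, and
  -- 2C₂C₃ brings the far part below half of Φ⁻¹(φ(r)).
  set E : ℝ≥0 := 2 * (C₁ * (C₂ * C₃))
  have hE : 1 ≤ E := one_le_mul (by norm_num) (one_le_mul hC₁ (one_le_mul hC₂ hC₃))
  have hE0 : (E : ℝ≥0∞) ≠ 0 := by simpa using (zero_lt_one.trans_le hE).ne'
  have hD0 : (D : ℝ≥0∞) ≠ 0 := by simpa using (zero_lt_one.trans_le hD).ne'
  have hC₁E : (C₁ : ℝ≥0∞) ≤ E := by
    have : C₁ ≤ E := by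
      calc C₁ = 1 * (C₁ * (1 * 1)) := by ring
        _ ≤ 2 * (C₁ * (C₂ * C₃)) := by gcongr; norm_num
    exact_mod_cast this
  have hCE : 2 * ((C₂ : ℝ≥0∞) * C₃) ≤ E := by
    have : 2 * (C₂ * C₃) ≤ E := by
      calc 2 * (C₂ * C₃) = 2 * (1 * (C₂ * C₃)) := by ring
        _ ≤ 2 * (C₁ * (C₂ * C₃)) := by gcongr
    exact_mod_cast this
  refine ⟨E * (2 * D), one_le_mul hE (one_le_mul (by norm_num) hD), fun F hF hmod => ?_⟩
  set G : Euc n → ℝ≥0∞ := fun x => F x / E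
  have hG : AEMeasurable G := hF.div_const _
  have hkey : ∀ (a : Euc n) (r : ℝ), 0 < r → ballAvg a r (fun x => Φ (maximal G x / 2)) ≤
      ((C₁ * (C₄ * 3 ^ n) + 1 : ℝ≥0) : ℝ≥0∞) * ENNReal.ofReal (φ r) := by
    intro a r hr
    set u := ENNReal.ofReal (φ r)
    set B := Metric.ball a (3 * r)
    have hB : MeasurableSet B := Metric.isOpen_ball.measurableSet
    set G₁ := B.indicator G
    set G₂ := Bᶜ.indicator G
    have hG₁ : AEMeasurable G₁ := hG.indicator hB
    have hfar : ∀ x ∈ Metric.ball a r, maximal G₂ x ≤ ginv Φ u / 2 := by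
      intro x hx
      refine maximal_indicator_compl_ball_le hr hx G fun s hs => ?_
      have hs0 : 0 < s := hr.trans hs
      have h1 : ballAvg x s F ≤ C₂ * (C₃ * ginv Φ u) :=
        (hjen x s _ F hs0 (hφ.ofReal_ne_zero hs0) ENNReal.ofReal_ne_top (hmod x s hs0)).trans
          (by gcongr; exact hginv r s hr hs0 (by linarith))
      calc ballAvg x s G = (E : ℝ≥0∞)⁻¹ * ballAvg x s F := by
            rw [← ballAvg_const_mul _ _ (by simpa using hE0)]
            congr with y
            rw [← ENNReal.div_eq_inv_mul]
        _ ≤ (2 * ((C₂ : ℝ≥0∞) * C₃))⁻¹ * (C₂ * (C₃ * ginv Φ u)) := by gcongr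
        _ = (((C₂ : ℝ≥0∞) * C₃)⁻¹ * (C₂ * C₃)) * (ginv Φ u / 2) := by
            rw [ENNReal.mul_inv (by simp) (by simp), div_eq_mul_inv]; ring
        _ = ginv Φ u / 2 := by
            rw [ENNReal.inv_mul_cancel, one_mul]
            · simpa using ⟨(zero_lt_one.trans_le hC₂).ne', (zero_lt_one.trans_le hC₃).ne'⟩
            · finiteness
    have hnear : ballAvg a r (fun x => Φ (maximal G₁ x)) ≤ C₁ * (C₄ * 3 ^ n) * u := by
      rw [ballAvg_le_iff a hr]
      calc ∫⁻ x in Metric.ball a r, Φ (maximal G₁ x)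
          ≤ ∫⁻ x, Φ (maximal G₁ x) := lintegral_mono' Measure.restrict_le_self le_rfl
        _ ≤ C₁ * ∫⁻ x, Φ (C₁ * G₁ x) := hstrong G₁ hG₁
        _ ≤ C₁ * ∫⁻ x, B.indicator (fun x => Φ (F x)) x := by
            gcongr with x
            by_cases hx : x ∈ B
            · simp only [G₁, indicator_of_mem hx]
              refine hΦ.mono ?_
              calc (C₁ : ℝ≥0∞) * (F x / E) ≤ E * (F x / E) := by gcongr
                _ = F x := ENNReal.mul_div_cancel hE0 (by simp)
            · simp [G₁, indicator_of_notMem hx, hΦ.map_zero]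
        _ = C₁ * ∫⁻ x in B, Φ (F x) := by rw [lintegral_indicator hB]
        _ ≤ C₁ * (ENNReal.ofReal (φ (3 * r)) * volume B) := by
            gcongr
            exact (ballAvg_le_iff a (by positivity) _ _).1 (hmod a (3 * r) (by positivity))
        _ ≤ C₁ * ((C₄ * u) * (ENNReal.ofReal (3 ^ n) * volume (Metric.ball a r))) := by
            gcongr
            · exact hdec r (3 * r) hr (by positivity) (by linarith)
            · rw [volume_ball_le_mul a a hr (by positivity : 0 < 3 * r),
                mul_div_cancel_right₀ _ hr.ne']
        _ = _ := by
            rw [ENNReal.ofReal_pow (by norm_num)]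
            simp only [ENNReal.ofReal_ofNat]
            ring
    calc ballAvg a r (fun x => Φ (maximal G x / 2))
        ≤ ballAvg a r (fun x => u + Φ (maximal G₁ x)) := ballAvg_mono fun x hx => by
          have h1 : maximal G x ≤ maximal G₁ x + maximal G₂ x := by
            refine le_trans (le_of_eq ?_) (maximal_add_le hG₁ G₂ x)
            congr with y
            exact (congrFun (indicator_self_add_compl B G) y).symm
          rcases le_total (maximal G₁ x) (maximal G₂ x) with hle | hle
          · refine le_trans (hΦ.mono ?_) ((hΦ.apply_half_ginv_le u).trans le_self_add)
            refine ENNReal.div_le_of_le_mul (h1.trans ?_)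
            rw [mul_two]
            exact add_le_add (hle.trans (hfar x hx)) (hfar x hx)
          · refine le_trans (hΦ.mono ?_) le_add_self
            refine ENNReal.div_le_of_le_mul (h1.trans ?_)
            rw [mul_two]
            gcongr
      _ = u + ballAvg a r (fun x => Φ (maximal G₁ x)) := ballAvg_const_add a hr u _
      _ ≤ u + C₁ * (C₄ * 3 ^ n) * u := by gcongr
      _ = _ := by push_cast; ring
  refine (habs φ _ hkey).mono hΦ.mono fun x => ?_
  rw [ENNReal.div_le_iff (by simp [hE0, hD0]) (by finiteness)]
  refine (maximal_le_mul_maximal_div F hE0 (by simp) x).trans (le_of_eq ?_)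
  push_cast
  rw [div_eq_mul_inv, div_eq_mul_inv]
  calc (E : ℝ≥0∞) * maximal G x = E * maximal G x * (2⁻¹ * 2) * ((D : ℝ≥0∞)⁻¹ * D) := by
        rw [ENNReal.inv_mul_cancel (by simp) (by simp), ENNReal.inv_mul_cancel hD0 (by simp)]; simp
    _ = _ := by ring

end Maximal

/-! ### Generalized fractional integrals of nonnegative functions -/

section Potential

variable {n : ℕ} {Φ Θ : ℝ≥0∞ → ℝ≥0∞} {φ ρ : ℝ → ℝ}

/-- The generalized fractional integral of a nonnegative function. -/
noncomputable def potential (ρ : ℝ → ℝ) (F : Euc n → ℝ≥0∞) (x : Euc n) : ℝ≥0∞ :=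
  ∫⁻ y, ‖ρ ‖x - y‖ / ‖x - y‖ ^ n‖ₑ * F y

/-- Bounded overlap of the dyadic dilates of an interval. -/
lemma exists_tsum_indicator_Ioo_le {K₁ K₂ : ℝ} (hK₁ : 0 < K₁) (hK : K₁ < K₂) :
    ∃ N : ℕ, ∀ (r t : ℝ) (w : ℤ → ℝ≥0∞) (H : ℝ≥0∞), 0 < r → 0 < t →
      (∀ j : ℤ, t ∈ Ioo (K₁ * (2 ^ j * r)) (K₂ * (2 ^ j * r)) → w j ≤ H) →
      ∑' j : ℤ, (Ioo (K₁ * (2 ^ j * r)) (K₂ * (2 ^ j * r))).indicator (fun _ => w j) t ≤ N * H := by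
  obtain ⟨N, hN⟩ := pow_unbounded_of_one_lt (K₂ / K₁) (one_lt_two (α := ℝ))
  have hK₂ : 0 < K₂ := hK₁.trans hK
  refine ⟨N, fun r t w H hr ht hw => ?_⟩
  -- With 2^J ≤ t/(K₂r) < 2^(J+1) and 2^N > K₂/K₁, the j-th interval contains `t` only if J < j ≤ J
  -- + N.
  obtain ⟨J, hJ, hJ'⟩ := exists_mem_Ico_zpow (x := t / (K₂ * r)) (y := 2) (by positivity)
    (by norm_num)
  rw [tsum_eq_sum (s := Finset.Ioc J (J + N))]
  · calc ∑ j ∈ Finset.Ioc J (J + N),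
          (Ioo (K₁ * (2 ^ j * r)) (K₂ * (2 ^ j * r))).indicator (fun _ => w j) t
        ≤ ∑ j ∈ Finset.Ioc J (J + N), H := by
          refine Finset.sum_le_sum fun j _ => ?_
          by_cases hj : t ∈ Ioo (K₁ * (2 ^ j * r)) (K₂ * (2 ^ j * r))
          · rw [indicator_of_mem hj]; exact hw j hj
          · rw [indicator_of_notMem hj]; exact zero_le
      _ = N * H := by simp
  · intro j hj
    refine indicator_of_notMem (fun hmem => hj ?_) _
    obtain ⟨h1, h2⟩ := hmem
    rw [Finset.mem_Ioc]
    constructor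
    · have h3 : (2 : ℝ) ^ J < 2 ^ j := by
        refine hJ.trans_lt ?_
        rw [div_lt_iff₀ (by positivity)]
        linarith
      exact (zpow_lt_zpow_iff_right₀ (by norm_num)).1 h3
    · have h3 : (2 : ℝ) ^ j < 2 ^ (J + 1 + N) := by
        rw [zpow_add₀ (by norm_num) (J + 1), zpow_natCast]
        have h4 : (2 : ℝ) ^ j < t / (K₂ * r) * (K₂ / K₁) := by
          rw [div_mul_div_comm, lt_div_iff₀ (by positivity)]
          calc (2 : ℝ) ^ j * (K₂ * r * K₁) = K₂ * (K₁ * (2 ^ j * r)) := by ring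
            _ < K₂ * t := by gcongr
            _ = t * K₂ := mul_comm _ _
        refine h4.trans ?_
        gcongr
      have := (zpow_lt_zpow_iff_right₀ (by norm_num)).1 h3
      omega

lemma IsFractionalKernel.aemeasurable_div (hρ : IsFractionalKernel ρ) :
    AEMeasurable (fun t => ENNReal.ofReal (ρ t / t)) (volume.restrict (Ioi 0)) :=
  (hρ.aemeasurable.div aemeasurable_id).ennreal_ofReal

/-- Dyadic decomposition of the generalized fractional integral. -/
lemma potential_le_tsum (hn : 1 ≤ n) (hpos : ∀ r, 0 < r → 0 < ρ r) {C : ℝ≥0} {K₁ K₂ : ℝ}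
    (hsup : ∀ r : ℝ, 0 < r → ⨆ t ∈ Icc r (2 * r), ENNReal.ofReal (ρ t) ≤
      (C : ℝ≥0∞) * ∫⁻ t in Ioo (K₁ * r) (K₂ * r), ENNReal.ofReal (ρ t / t))
    {F : Euc n → ℝ≥0∞} (hF : AEMeasurable F) (x : Euc n) {r : ℝ} (hr : 0 < r) :
    potential ρ F x ≤ C * ENNReal.ofReal (2 ^ n) * volume (Metric.ball (0 : Euc n) 1) *
      ∑' j : ℤ, (∫⁻ t in Ioo (K₁ * (2 ^ j * r)) (K₂ * (2 ^ j * r)), ENNReal.ofReal (ρ t / t)) *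
        ballAvg x (2 * (2 ^ j * r)) F := by
  set V := volume (Metric.ball (0 : Euc n) 1)
  set A : ℤ → Set (Euc n) := fun j => {y | ‖x - y‖ ∈ Icc (2 ^ j * r) (2 * (2 ^ j * r))} ∩
    Metric.ball x (2 * (2 ^ j * r))
  set q : Euc n → ℝ≥0∞ := fun y => ‖ρ ‖x - y‖ / ‖x - y‖ ^ n‖ₑ * F y
  have hsupp : Function.support q ⊆ ⋃ j, A j := by
    intro y hy
    have hd : 0 < ‖x - y‖ := by
      -- At y = x the kernel is ρ(0)/0ⁿ = 0 by the convention on division by zero, since n ≥ 1; the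
      -- dyadic annuli therefore cover the support.
      by_contra! hc
      have h0 : ‖x - y‖ = 0 := le_antisymm hc (norm_nonneg _)
      simp [q, h0, zero_pow (show n ≠ 0 by omega)] at hy
    obtain ⟨j, hj, hj'⟩ := exists_mem_Ico_zpow (x := ‖x - y‖ / r) (y := 2) (by positivity)
      (by norm_num)
    rw [le_div_iff₀ hr] at hj
    rw [div_lt_iff₀ hr, zpow_add_one₀ (by norm_num), mul_comm _ (2 : ℝ), mul_assoc] at hj'
    refine mem_iUnion.2 ⟨j, ⟨hj, hj'.le⟩, ?_⟩
    rwa [Metric.mem_ball, dist_comm, dist_eq_norm]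
  have hann : ∀ j, ∫⁻ y in A j, q y ≤ C * ENNReal.ofReal (2 ^ n) * V *
      ((∫⁻ t in Ioo (K₁ * (2 ^ j * r)) (K₂ * (2 ^ j * r)), ENNReal.ofReal (ρ t / t)) *
        ballAvg x (2 * (2 ^ j * r)) F) := by
    intro j
    set s := (2 : ℝ) ^ j * r
    have hs : 0 < s := by positivity
    set P := ∫⁻ t in Ioo (K₁ * s) (K₂ * s), ENNReal.ofReal (ρ t / t)
    have hA : MeasurableSet (A j) :=
      (measurableSet_Icc.preimage (by fun_prop)).inter Metric.isOpen_ball.measurableSet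
    calc ∫⁻ y in A j, q y ≤ ∫⁻ y in A j, (C * P * (ENNReal.ofReal (s ^ n))⁻¹) * F y := by
          refine setLIntegral_mono' hA fun y hy => ?_
          have hd : 0 < ‖x - y‖ := hs.trans_le hy.1.1
          simp only [q]
          gcongr
          rw [Real.enorm_eq_ofReal (div_nonneg (hpos _ hd).le (by positivity)),
            ENNReal.ofReal_div_of_pos (by positivity), div_eq_mul_inv]
          gcongr
          · exact (le_iSup₂ (f := fun t (_ : t ∈ Icc s (2 * s)) => ENNReal.ofReal (ρ t)) _
              hy.1).trans (hsup s hs)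
          · exact hy.1.1
      _ = (C * P * (ENNReal.ofReal (s ^ n))⁻¹) * ∫⁻ y in A j, F y := by
          rw [lintegral_const_mul'' _ hF.restrict]
      _ ≤ (C * P * (ENNReal.ofReal (s ^ n))⁻¹) * ∫⁻ y in Metric.ball x (2 * s), F y := by
          gcongr
          exact inter_subset_right
      _ = (C * P * (ENNReal.ofReal (s ^ n))⁻¹) *
            (ballAvg x (2 * s) F * (ENNReal.ofReal (2 ^ n) * ENNReal.ofReal (s ^ n) * V)) := by
          rw [setLIntegral_ball_eq x (by positivity : 0 < 2 * s), volume_ball_eq x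
            (by positivity : 0 < 2 * s), mul_pow 2 s, ENNReal.ofReal_mul (by positivity)]
      _ = C * ENNReal.ofReal (2 ^ n) * V * (P * ballAvg x (2 * s) F) *
            ((ENNReal.ofReal (s ^ n))⁻¹ * ENNReal.ofReal (s ^ n)) := by ring
      _ = _ := by
          rw [ENNReal.inv_mul_cancel _ ENNReal.ofReal_ne_top, mul_one]
          exact (ENNReal.ofReal_pos.2 (by positivity)).ne'
  calc potential ρ F x = ∫⁻ y in ⋃ j, A j, q y := by
        rw [potential, setLIntegral_eq_of_support_subset hsupp]
    _ ≤ ∑' j, ∫⁻ y in A j, q y := lintegral_iUnion_le _ _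
    _ ≤ _ := by
        rw [← ENNReal.tsum_mul_left]
        exact ENNReal.tsum_le_tsum hann

/-- Hedberg's splitting of the fractional integral at a radius proportional to `r`. -/
lemma IsFractionalKernel.exists_potential_le (hn : 1 ≤ n) (hρ : IsFractionalKernel ρ)
    (hφ : IsGdec n φ) (hΦ : IsPhi Φ) (hq : QuasiConvex Φ) :
    ∃ (C : ℝ≥0) (l : ℝ), 1 ≤ C ∧ 1 < l ∧ ∀ F : Euc n → ℝ≥0∞, AEMeasurable F → ModularLE Φ φ F →
      ∀ (x : Euc n) (r : ℝ), 0 < r → potential ρ F x ≤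
        C * (maximal F x * (∫⁻ t in Ioo 0 (l * r), ENNReal.ofReal (ρ t / t)) +
          ∫⁻ t in Ioi r, ENNReal.ofReal (ρ t / t) * ginv Φ (ENNReal.ofReal (φ t))) := by
  obtain ⟨C, K₁, K₂, hC, hK₁, hK, hsup⟩ := hρ.sup_le
  have hK₂ : 0 < K₂ := hK₁.trans hK
  obtain ⟨N, hN⟩ := exists_tsum_indicator_Ioo_le hK₁ hK
  obtain ⟨C₁, hC₁, hjen⟩ := hq.exists_ballAvg_le (n := n) hΦ
  obtain ⟨C₂, hC₂, hginv⟩ := hq.exists_ginv_le hφ (le_max_left 1 K₂)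
  set V := volume (Metric.ball (0 : Euc n) 1)
  set D : ℝ≥0 := C * 2 ^ n * V.toNNReal
  have hD : (D : ℝ≥0∞) = C * ENNReal.ofReal (2 ^ n) * V := by
    simp only [D]
    push_cast
    rw [ENNReal.coe_toNNReal (volume_ball_ne_top 0 1), ENNReal.ofReal_pow (by norm_num),
      ENNReal.ofReal_ofNat]
  refine ⟨max 1 (D * (N * (C₁ * C₂))), K₂ / K₁, le_max_left _ _, (one_lt_div hK₁).2 hK,
    fun F hFm hF x R hR => ?_⟩
  -- With K₁r = R, the intervals of index j ≥ 0 lie in (R, ∞) and those of index j < 0 in (0, K₂r) =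
  -- (0, (K₂/K₁)R).
  set r := R / K₁
  have hr : 0 < r := by positivity
  have hrR : K₁ * r = R := mul_div_cancel₀ _ hK₁.ne'
  have hlR : K₂ / K₁ * R = K₂ * r := by simp only [r]; ring
  rw [hlR]
  set g : ℝ → ℝ≥0∞ := fun t => ENNReal.ofReal (ρ t / t)
  set I : ℤ → Set ℝ := fun j => Ioo (K₁ * (2 ^ j * r)) (K₂ * (2 ^ j * r))
  have hI0 : ∀ j, I j ⊆ Ioi 0 := fun j t ht => lt_trans (by positivity) ht.1
  set w : ℤ → ℝ≥0∞ := fun j => ballAvg x (2 * (2 ^ j * r)) F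
  set M := maximal F x
  set h₁ : ℝ → ℝ≥0∞ := (Ioo 0 (K₂ * r)).indicator (fun t => g t * M)
  set h₂ : ℝ → ℝ≥0∞ := (Ioi R).indicator (fun t => g t * ginv Φ (ENNReal.ofReal (φ t)))
  -- Small annuli are controlled by the maximal function. Large ones use Jensen at the level φ(2·2^j
  -- r), which is comparable with φ(t) from above because t < K₂2^j r.
  have hw : ∀ t, 0 < t → ∀ j, t ∈ I j → g t * w j ≤ h₁ t + C₁ * C₂ * h₂ t := by
    intro t ht0 j hj
    have hs : (0 : ℝ) < 2 ^ j * r := by positivity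
    rcases lt_or_ge j 0 with hj0 | hj0
    · refine le_trans ?_ le_self_add
      simp only [h₁]
      rw [indicator_of_mem]
      · gcongr
        exact ballAvg_le_maximal _ _ (by positivity)
      · refine ⟨ht0, hj.2.trans_le ?_⟩
        gcongr
        exact mul_le_of_le_one_left hr.le (zpow_le_one_of_nonpos₀ (by norm_num) hj0.le)
    · refine le_trans ?_ le_add_self
      simp only [h₂]
      rw [indicator_of_mem]
      · calc g t * w j ≤ g t * (C₁ * (C₂ * ginv Φ (ENNReal.ofReal (φ t)))) := by
              gcongr
              refine (hjen x _ _ F (by positivity) (hφ.ofReal_ne_zero (by positivity))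
                ENNReal.ofReal_ne_top (hF x _ (by positivity))).trans ?_
              gcongr
              refine hginv t _ ht0 (by positivity) (hj.2.le.trans ?_)
              calc K₂ * (2 ^ j * r) ≤ max 1 K₂ * (1 * (2 ^ j * r)) := by
                    rw [one_mul]; gcongr; exact le_max_right _ _
                _ ≤ _ := by gcongr; norm_num
          _ = _ := by ring
      · refine lt_of_le_of_lt ?_ hj.1
        rw [← hrR]
        gcongr
        exact le_mul_of_one_le_left hr.le (one_le_zpow₀ (by norm_num) hj0)
  have hgm : AEMeasurable g (volume.restrict (Ioi 0)) := hρ.aemeasurable_div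
  have hsum : ∑' j, (∫⁻ t in I j, g t) * w j ≤
      N * (M * (∫⁻ t in Ioo 0 (K₂ * r), g t) + C₁ * C₂ * ∫⁻ t in Ioi R, g t *
        ginv Φ (ENNReal.ofReal (φ t))) := by
    calc ∑' j, (∫⁻ t in I j, g t) * w j
        = ∑' j, ∫⁻ t in Ioi 0, (I j).indicator (fun t => g t * w j) t := by
          congr with j
          rw [setLIntegral_indicator measurableSet_Ioo, inter_eq_left.2 (hI0 j),
            lintegral_mul_const'' _ (hgm.mono_set (hI0 j))]
      _ = ∫⁻ t in Ioi 0, ∑' j, (I j).indicator (fun t => g t * w j) t := by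
          rw [lintegral_tsum fun j => (hgm.mul_const _).indicator measurableSet_Ioo]
      _ ≤ ∫⁻ t in Ioi 0, N * (h₁ t + C₁ * C₂ * h₂ t) := by
          refine setLIntegral_mono' measurableSet_Ioi fun t ht => ?_
          exact hN r t (fun j => g t * w j) _ hr ht (hw t ht)
      _ = N * ((∫⁻ t in Ioi 0, h₁ t) + C₁ * C₂ * ∫⁻ t in Ioi 0, h₂ t) := by
          rw [lintegral_const_mul' _ _ (by simp), lintegral_add_left'
            ((hgm.mul_const _).indicator measurableSet_Ioo), lintegral_const_mul' _ _ (by finiteness)]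
      _ = _ := by
          rw [setLIntegral_indicator measurableSet_Ioo, setLIntegral_indicator measurableSet_Ioi,
            inter_eq_left.2 Ioo_subset_Ioi_self, inter_eq_left.2 (Ioi_subset_Ioi hR.le),
            lintegral_mul_const'' _ (hgm.mono_set Ioo_subset_Ioi_self), mul_comm M]
  have h1C : (1 : ℝ≥0∞) ≤ C₁ * C₂ := by exact_mod_cast one_le_mul hC₁ hC₂
  calc potential ρ F x ≤ D * ∑' j, (∫⁻ t in I j, g t) * w j := by
        rw [hD]; exact potential_le_tsum hn hρ.pos hsup hFm x hr
    _ ≤ D * (N * (C₁ * C₂ * (M * (∫⁻ t in Ioo 0 (K₂ * r), g t)) + C₁ * C₂ * ∫⁻ t in Ioi R, g t *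
        ginv Φ (ENNReal.ofReal (φ t)))) := by
        gcongr
        refine hsum.trans ?_
        exact mul_le_mul' le_rfl (add_le_add (le_mul_of_one_le_left' h1C) le_rfl)
    _ = ((D * (N * (C₁ * C₂)) : ℝ≥0) : ℝ≥0∞) * (M * (∫⁻ t in Ioo 0 (K₂ * r), g t) +
        ∫⁻ t in Ioi R, g t * ginv Φ (ENNReal.ofReal (φ t))) := by
        push_cast; ring
    _ ≤ _ := by gcongr; exact le_max_right _ _

/-- Hedberg's inequality. -/
lemma IsFractionalKernel.exists_potential_le_ginv (hn : 1 ≤ n) (hρ : IsFractionalKernel ρ)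
    (hφ : IsGdec n φ) (hΦ : IsPhi Φ) (hq : QuasiConvex Φ) (hqΘ : QuasiConvex Θ)
    (hc : FractionalCondition ρ φ Φ Θ) :
    ∃ C : ℝ≥0, 1 ≤ C ∧ ∀ F : Euc n → ℝ≥0∞, AEMeasurable F → ModularLE Φ φ F →
      ∀ (x : Euc n) (r : ℝ), 0 < r → potential ρ F x ≤ C * ginv Θ (ENNReal.ofReal (φ r)) *
        (1 + maximal F x / ginv Φ (ENNReal.ofReal (φ r))) := by
  obtain ⟨C, l, hC, hl, hpot⟩ := hρ.exists_potential_le hn hφ hΦ hq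
  obtain ⟨C₁, hC₁, hginv⟩ := hq.exists_ginv_le hφ hl.le
  obtain ⟨C₂, hC₂, hginvΘ⟩ := hqΘ.exists_ginv_le hφ le_rfl
  obtain ⟨C₀, hC₀, hc⟩ := hc
  refine ⟨max 1 (C * (C₀ * C₂ * C₁)), le_max_left _ _, fun F hFm hF x r hr => ?_⟩
  set M := maximal F x
  set g := ginv Φ (ENNReal.ofReal (φ r))
  set θ := ginv Θ (ENNReal.ofReal (φ r))
  have hg0 : g ≠ 0 := (hΦ.ginv_pos (hφ.ofReal_ne_zero hr)).ne'
  have hgt : g ≠ ∞ := (hΦ.ginv_lt_top ENNReal.ofReal_ne_top).ne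
  have hlr : 0 < l * r := by positivity
  set X := ∫⁻ t in Ioo 0 (l * r), ENNReal.ofReal (ρ t / t)
  -- The integral condition is applied at the radius lr; comparing Φ⁻¹(φ) and Θ⁻¹(φ) at lr and at r
  -- brings it back to r.
  have hX : X ≤ C₀ * C₂ * C₁ * θ / g := by
    rw [ENNReal.le_div_iff_mul_le (.inl hg0) (.inl hgt)]
    calc X * g ≤ X * (C₁ * ginv Φ (ENNReal.ofReal (φ (l * r)))) := by
          gcongr; exact hginv (l * r) r hlr hr le_rfl
      _ = C₁ * (X * ginv Φ (ENNReal.ofReal (φ (l * r)))) := by ring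
      _ ≤ C₁ * (C₀ * (C₂ * θ)) := by
          gcongr C₁ * ?_
          refine (le_self_add.trans (hc _ hlr)).trans ?_
          gcongr
          exact hginvΘ r (l * r) hr hlr (by nlinarith)
      _ = _ := by ring
  have hY : ∫⁻ t in Ioi r, ENNReal.ofReal (ρ t / t) * ginv Φ (ENNReal.ofReal (φ t)) ≤
      C₀ * C₂ * C₁ * θ := by
    refine (le_add_self.trans (hc r hr)).trans ?_
    have h1 : (1 : ℝ≥0∞) ≤ C₂ * C₁ := by exact_mod_cast one_le_mul hC₂ hC₁
    rw [mul_assoc (C₀ : ℝ≥0∞)]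
    gcongr
    exact le_mul_of_one_le_right' h1
  calc potential ρ F x ≤ C * (M * X + _) := hpot F hFm hF x r hr
    _ ≤ C * (M * (C₀ * C₂ * C₁ * θ / g) + C₀ * C₂ * C₁ * θ) := by gcongr
    _ = ((C * (C₀ * C₂ * C₁) : ℝ≥0) : ℝ≥0∞) * θ * (1 + M / g) := by
        push_cast; rw [div_eq_mul_inv, div_eq_mul_inv]; ring
    _ ≤ _ := by gcongr; exact le_max_right _ _

/-- Boundedness of the generalized fractional integral in modular form. -/
lemma IsNabla2.exists_modularLE_potential (hn : 1 ≤ n) (hΦ : IsNabla2 Φ) (hΘ : IsPhi Θ)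
    (hqΘ : QuasiConvex Θ) (hφ : IsGdec n φ) (hint : IntegralCondition φ)
    (hρ : IsFractionalKernel ρ) (hc : FractionalCondition ρ φ Φ Θ) :
    ∃ L : ℝ≥0, 1 ≤ L ∧ ∀ F : Euc n → ℝ≥0∞, AEMeasurable F → ModularLE Φ φ F →
      ModularLE Θ φ (fun x => potential ρ F x / L) := by
  have hP := hΦ.isPhi
  have hq := hΦ.quasiConvex
  obtain ⟨C, hC, hhed⟩ := hρ.exists_potential_le_ginv hn hφ hP hq hqΘ hc
  obtain ⟨C₁, hC₁, hjen⟩ := hq.exists_ballAvg_le (n := n) hP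
  obtain ⟨C₄, hC₄, hdec⟩ := hφ.exists_le_mul (one_le_two)
  obtain ⟨L₀, hL₀, hmax⟩ := hΦ.exists_modularLE_maximal hn hφ
  obtain ⟨E, hE, habs⟩ := hqΘ.exists_modularLE_div (n := n) hΘ hC₄
  -- L₀ serves the maximal inequality; 2C₁ guarantees an admissible starting radius in `hne`.
  set L₁ := max L₀ (2 * C₁)
  have hL₁ : 1 ≤ L₁ := hL₀.trans (le_max_left _ _)
  have hL₁0 : (L₁ : ℝ≥0∞) ≠ 0 := by simpa using (zero_lt_one.trans_le hL₁).ne'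
  set D : ℝ≥0 := 2 * (C * (1 + L₁))
  have hD : 1 ≤ D := one_le_mul (by norm_num) (one_le_mul hC le_self_add)
  have hD0 : (D : ℝ≥0∞) ≠ 0 := by simpa using (zero_lt_one.trans_le hD).ne'
  have hE0 : (E : ℝ≥0∞) ≠ 0 := by simpa using (zero_lt_one.trans_le hE).ne'
  have hC₁0 : (C₁ : ℝ≥0∞) ≠ 0 := by simpa using (zero_lt_one.trans_le hC₁).ne'
  have hC₄0 : (C₄ : ℝ≥0∞) ≠ 0 := by simpa using (zero_lt_one.trans_le hC₄).ne'
  refine ⟨D * E, one_le_mul hD hE, fun F hFm hF => ?_⟩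
  -- The pointwise core: find R such that φ(R) bounds the left side while φ(2R) is already below
  -- Φ(M/L₁). As φ need not be continuous, R is sought among dyadic multiples of a starting radius.
  have hpt : ∀ x, Θ (potential ρ F x / D) ≤ C₄ * Φ (maximal F x / L₁) := by
    intro x
    set M := maximal F x
    rcases eq_or_ne M ∞ with hM | hM
    · rw [hM, ENNReal.top_div_coe, hP.apply_top, ENNReal.mul_top hC₄0]
      exact le_top
    have hA : ∀ R, 0 < R → M / L₁ ≤ ginv Φ (ENNReal.ofReal (φ R)) →
        Θ (potential ρ F x / D) ≤ ENNReal.ofReal (φ R) := by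
      intro R hR hMR
      refine le_trans (hΘ.mono ?_) (hΘ.apply_half_ginv_le _)
      refine ENNReal.div_le_of_le_mul ((hhed F hFm hF x R hR).trans ?_)
      set g := ginv Φ (ENNReal.ofReal (φ R))
      set θ := ginv Θ (ENNReal.ofReal (φ R))
      have hMg : M / g ≤ L₁ := by
        refine ENNReal.div_le_of_le_mul ?_
        rwa [ENNReal.div_le_iff hL₁0 (by simp), mul_comm] at hMR
      calc C * θ * (1 + M / g) ≤ C * θ * (1 + L₁) * (2⁻¹ * 2) := by
            rw [ENNReal.inv_mul_cancel (by simp) (by simp), mul_one]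
            gcongr
        _ = θ / 2 * D := by
            simp only [D]; push_cast; rw [div_eq_mul_inv]; ring
    -- A ball whose average exceeds M/2 works: by Jensen, M/2 ≤ C₁ Φ⁻¹(φ(R)).
    have hne : ∃ R, 0 < R ∧ M / L₁ ≤ ginv Φ (ENNReal.ofReal (φ R)) := by
      rcases eq_or_ne M 0 with hM0 | hM0
      · exact ⟨1, one_pos, by simp [hM0]⟩
      have hlt : M / 2 < maximal F x := ENNReal.half_lt_self hM0 hM
      rw [maximal, lt_iSup_iff] at hlt
      obtain ⟨R, hlt⟩ := hlt
      obtain ⟨hR, hlt⟩ := lt_iSup_iff.1 hlt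
      refine ⟨R, hR, ?_⟩
      have h1 := hlt.le.trans (hjen x R _ F hR (hφ.ofReal_ne_zero hR) ENNReal.ofReal_ne_top
        (hF x R hR))
      rw [ENNReal.div_le_iff (by simp) (by simp)] at h1
      rw [ENNReal.div_le_iff hL₁0 (by simp)]
      refine h1.trans ?_
      have h2 : (2 : ℝ≥0∞) * C₁ ≤ L₁ := by exact_mod_cast le_max_right L₀ (2 * C₁)
      calc C₁ * ginv Φ (ENNReal.ofReal (φ R)) * 2
          = ginv Φ (ENNReal.ofReal (φ R)) * (2 * C₁) := by ring
        _ ≤ _ := by gcongr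
    obtain ⟨R₀, hR₀, hMR₀⟩ := hne
    -- If every doubling stays admissible, then φ(2^j R₀) becomes arbitrarily small by the decay of
    -- φ, and the left side must be 0.
    by_cases hall : ∀ j : ℕ, M / L₁ ≤ ginv Φ (ENNReal.ofReal (φ (2 ^ j * R₀)))
    · refine le_trans (le_of_eq ?_) (zero_le (a := C₄ * Φ (M / L₁)))
      by_contra hv
      set v := Θ (potential ρ F x / D)
      set u := ENNReal.ofReal (φ R₀)
      have hu0 : u ≠ 0 := hφ.ofReal_ne_zero hR₀
      have hvt : v / 2 / u ≠ ∞ := by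
        have : v ≠ ∞ := ne_top_of_le_ne_top ENNReal.ofReal_ne_top (hA R₀ hR₀ hMR₀)
        exact ENNReal.div_ne_top (ENNReal.div_ne_top this (by simp)) hu0
      obtain ⟨m, -, hm⟩ := hφ.exists_pow_two_decay hint (ε := (v / 2 / u).toNNReal)
        (ENNReal.toNNReal_pos (ENNReal.div_pos (ENNReal.half_pos hv).ne'
          ENNReal.ofReal_ne_top).ne' hvt)
      have h1 := (hA _ (by positivity) (hall m)).trans (hm R₀ hR₀)
      rw [ENNReal.coe_toNNReal hvt, ENNReal.div_mul_cancel hu0 ENNReal.ofReal_ne_top] at h1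
      have : v ≠ ∞ := ne_top_of_le_ne_top ENNReal.ofReal_ne_top (hA R₀ hR₀ hMR₀)
      exact absurd h1 (not_le.2 (ENNReal.half_lt_self hv this))
    · push Not at hall
      classical
      have hj := Nat.find_spec hall
      obtain ⟨i, hi⟩ : ∃ i, Nat.find hall = i + 1 := by
        refine Nat.exists_eq_succ_of_ne_zero fun h0 => ?_
        rw [h0] at hj
        simp only [pow_zero, one_mul] at hj
        exact absurd hMR₀ (not_le.2 hj)
      -- The last admissible radius: its double fails, so φ there is below Φ(M/L₁), and doubling
      -- compares the two values of φ.
      have hi' := not_lt.1 (Nat.find_min hall (show i < Nat.find hall by omega))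
      rw [hi] at hj
      have hR : 0 < 2 ^ i * R₀ := by positivity
      refine (hA _ hR hi').trans ?_
      calc ENNReal.ofReal (φ (2 ^ i * R₀)) ≤ C₄ * ENNReal.ofReal (φ (2 ^ (i + 1) * R₀)) := by
            refine hdec _ _ (by positivity) hR (le_of_eq ?_)
            rw [pow_succ']; ring
        _ ≤ _ := by gcongr; exact (lt_apply_of_ginv_lt hP.mono hj).le
  have hkey : ∀ (a : Euc n) (r : ℝ), 0 < r →
      ballAvg a r (fun x => Θ (potential ρ F x / D)) ≤ C₄ * ENNReal.ofReal (φ r) := by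
    intro a r hr
    calc ballAvg a r (fun x => Θ (potential ρ F x / D))
        ≤ ballAvg a r (fun x => C₄ * Φ (maximal F x / L₀)) := ballAvg_mono fun x _ =>
          (hpt x).trans (by
            gcongr
            refine hP.mono ?_
            gcongr
            exact le_max_left _ _)
      _ = C₄ * ballAvg a r (fun x => Φ (maximal F x / L₀)) :=
          ballAvg_const_mul _ _ (by simp) _
      _ ≤ _ := by gcongr; exact hmax F hFm hF a r hr
  refine (habs φ _ hkey).mono hΘ.mono fun x => le_of_eq ?_
  push_cast
  rw [div_eq_mul_inv, div_eq_mul_inv, div_eq_mul_inv, ENNReal.mul_inv (by simp) (by simp), mul_assoc]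

end Potential

/-! ### Orlicz-Campanato functions are Orlicz-Morrey functions modulo constants -/

section Campanato

variable {n : ℕ} {Φ : ℝ≥0∞ → ℝ≥0∞} {φ : ℝ → ℝ} {𝕜 : Type*} [RCLike 𝕜]

lemma edist_average_le {b : Euc n → 𝕜} (hb : LocallyIntegrable b volume) (a : Euc n) {r : ℝ}
    (hr : 0 < r) (z : 𝕜) :
    edist (⨍ y in Metric.ball a r, b y ∂volume) z ≤ ballAvg a r (fun x => ‖b x - z‖ₑ) := by
  have hint : IntegrableOn b (Metric.ball a r) volume :=
    (hb.integrableOn_isCompact (isCompact_closedBall a r)).mono_set Metric.ball_subset_closedBall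
  have : NeZero (volume.restrict (Metric.ball a r)) :=
    ⟨by simpa using volume_ball_ne_zero a hr⟩
  have : IsFiniteMeasure (volume.restrict (Metric.ball a r)) :=
    ⟨by simpa using measure_ball_lt_top⟩
  have hint' : Integrable b
      ((volume.restrict (Metric.ball a r) univ)⁻¹ • volume.restrict (Metric.ball a r)) :=
    hint.integrable.to_average
  rw [edist_eq_enorm_sub, ballAvg]
  calc ‖(⨍ y in Metric.ball a r, b y ∂volume) - z‖ₑ
      = ‖⨍ y in Metric.ball a r, (b y - z) ∂volume‖ₑ := by
        rw [average, average, integral_sub hint' (integrable_const z), integral_const,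
          probReal_univ, one_smul]
    _ ≤ _ := by
        rw [average, laverage]
        exact enorm_integral_le_lintegral_enorm _

lemma edist_average_ball_le {b : Euc n → 𝕜} (hb : LocallyIntegrable b volume) {C c u : ℝ≥0∞}
    (hc0 : c ≠ 0) (hc : c ≠ ∞) {a a' : Euc n} {r r' : ℝ} (hr : 0 < r) (hr' : 0 < r')
    (hsub : Metric.ball a r ⊆ Metric.ball a' r')
    (h : ballAvg a' r' (fun x => ‖b x - ⨍ y in Metric.ball a' r', b y ∂volume‖ₑ / c) ≤ C * u) :
    edist (⨍ y in Metric.ball a r, b y ∂volume) (⨍ y in Metric.ball a' r', b y ∂volume) ≤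
      ENNReal.ofReal ((r' / r) ^ n) * C * c * u := by
  refine (edist_average_le hb a hr _).trans ((ballAvg_subset hr hr' hsub _).trans ?_)
  rw [mul_assoc, mul_assoc]
  gcongr
  calc ballAvg a' r' (fun x => ‖b x - ⨍ y in Metric.ball a' r', b y ∂volume‖ₑ)
      = c * ballAvg a' r' (fun x => ‖b x - ⨍ y in Metric.ball a' r', b y ∂volume‖ₑ / c) := by
        rw [← ballAvg_const_mul _ _ hc]
        congr with y
        rw [ENNReal.mul_div_cancel hc0 hc]
    _ ≤ c * (C * u) := by gcongr
    _ = _ := by ring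

/-- A function in the Orlicz-Campanato space differs from a function in the Orlicz-Morrey space
by a constant, the limit of its averages over large balls. -/
lemma IsDelta2.exists_modularLE_sub_const (hΦ : IsDelta2 Φ) (hq : QuasiConvex Φ)
    (hφ : IsGdec n φ) (hint : IntegralCondition φ) :
    ∃ C : ℝ≥0, 1 ≤ C ∧ ∀ (b : Euc n → 𝕜) (c : ℝ≥0∞), LocallyIntegrable b volume → c ≠ 0 → c ≠ ∞ →
      (∀ (a : Euc n) (r : ℝ), 0 < r →
        ballAvg a r (fun x => Φ (‖b x - ⨍ y in Metric.ball a r, b y ∂volume‖ₑ / c)) ≤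
          ENNReal.ofReal (φ r)) →
      ∃ σ : 𝕜, ModularLE Φ φ (fun x => ‖b x - σ‖ₑ / (C * c)) := by
  have hP := hΦ.isPhi
  obtain ⟨C₁, hC₁, hjen⟩ := hq.exists_ballAvg_le (n := n) hP
  obtain ⟨C₂, hC₂, hhalf⟩ := hΦ.exists_ginv_div_le
  -- Chosen so that passing from r to 2^m r divides φ by at least C₂ and hence, by Δ₂, halves
  -- Φ⁻¹(φ).
  obtain ⟨m, hm0, hdec⟩ := hφ.exists_pow_two_decay hint (ε := C₂⁻¹) (by positivity)
  obtain ⟨D, hD, habs⟩ := hq.exists_modularLE_div (n := n) hP (l := 2) (by norm_num)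
  set lam : ℝ := 2 ^ m
  have hlam : 1 < lam := one_lt_pow₀ (by norm_num) hm0.ne'
  have hlam0 : 0 < lam := by positivity
  set h : ℝ → ℝ≥0∞ := fun r => ginv Φ (ENNReal.ofReal (φ r))
  have hhtop : ∀ r, h r ≠ ∞ := fun r => (hP.ginv_lt_top ENNReal.ofReal_ne_top).ne
  have hstep : ∀ r, 0 < r → h (lam * r) ≤ 2⁻¹ * h r := fun r hr => by
    refine (ginv_mono Φ ?_).trans (hhalf _ ENNReal.ofReal_ne_top)
    refine (hdec r hr).trans_eq ?_
    rw [ENNReal.coe_inv hC₂.ne', ENNReal.div_eq_inv_mul]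
  have hpow : ∀ (r : ℝ) (i : ℕ), 0 < r → h (lam ^ i * r) ≤ h r / 2 ^ i := fun r i hr => by
    induction i with
    | zero => simp
    | succ i ih =>
      rw [pow_succ', mul_assoc]
      refine (hstep _ (by positivity)).trans ?_
      calc 2⁻¹ * h (lam ^ i * r) ≤ 2⁻¹ * (h r / 2 ^ i) := by gcongr
        _ = _ := by
          rw [pow_succ', div_eq_mul_inv, div_eq_mul_inv,
            ENNReal.mul_inv (by simp) (by simp)]
          ring
  set B : ℝ≥0 := (lam ^ n).toNNReal * C₁
  have hB : 1 ≤ B := by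
    refine one_le_mul ?_ hC₁
    rw [Real.one_le_toNNReal]
    exact one_le_pow₀ hlam.le
  -- The 8 is a product of three factors 2: the larger term in the triangle inequality, the
  -- geometric series, and the half in Φ(Φ⁻¹(u)/2) ≤ u.
  refine ⟨8 * B * D, one_le_mul (one_le_mul (by norm_num) hB) hD, fun b c hb hc0 hc hmod => ?_⟩
  set mean : Euc n → ℝ → 𝕜 := fun a r => ⨍ y in Metric.ball a r, b y ∂volume
  have hmean : ∀ (a a' : Euc n) (r r' : ℝ), 0 < r → 0 < r' → Metric.ball a r ⊆ Metric.ball a' r' →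
      edist (mean a r) (mean a' r') ≤ ENNReal.ofReal ((r' / r) ^ n) * C₁ * c * h r' := by
    intro a a' r r' hr hr' hsub
    exact edist_average_ball_le hb hc0 hc hr hr' hsub (hjen a' r' _ _ hr' (hφ.ofReal_ne_zero hr')
      ENNReal.ofReal_ne_top (hmod a' r' hr'))
  -- Successive averages differ by at most B c h(r)/2^i, so they form a Cauchy sequence whose limit
  -- is within twice the first bound.
  have hlim : ∀ (a : Euc n) (r : ℝ), 0 < r → ∃ σ, Tendsto (fun i : ℕ => mean a (lam ^ i * r)) atTop
      (𝓝 σ) ∧ edist (mean a r) σ ≤ 2 * (B * c * h r) := by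
    intro a r hr
    have hK : B * c * h r ≠ ∞ := ENNReal.mul_ne_top (by finiteness) (hhtop r)
    have hgeo : ∀ i : ℕ, edist (mean a (lam ^ i * r)) (mean a (lam ^ (i + 1) * r)) ≤
        B * c * h r / 2 ^ i := by
      intro i
      have hi : 0 < lam ^ i * r := by positivity
      refine (hmean a a _ _ hi (by positivity) (Metric.ball_subset_ball ?_)).trans ?_
      · gcongr
        · exact hlam.le
        · omega
      · rw [mul_div_assoc (B * c : ℝ≥0∞)]
        have h1 : lam ^ (i + 1) * r / (lam ^ i * r) = lam := by
          rw [pow_succ']; field_simp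
        rw [h1]
        simp only [B, ENNReal.coe_mul]
        refine mul_le_mul' le_rfl ?_
        rw [pow_succ', mul_assoc]
        refine (hstep _ hi).trans ?_
        calc 2⁻¹ * h (lam ^ i * r) ≤ 1 * h (lam ^ i * r) := by gcongr; simp
          _ ≤ _ := by rw [one_mul]; exact hpow r i hr
    obtain ⟨σ, hσ⟩ := cauchySeq_tendsto_of_complete
      (cauchySeq_of_edist_le_geometric_two _ hK hgeo)
    refine ⟨σ, hσ, ?_⟩
    have := edist_le_of_edist_le_geometric_two_of_tendsto₀ _ hgeo hσ
    simpa using this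
  obtain ⟨σ, hσ, -⟩ := hlim 0 1 one_pos
  have hσ_le : ∀ (a : Euc n) (r : ℝ), 0 < r → edist (mean a r) σ ≤ 2 * (B * c * h r) := by
    intro a r hr
    obtain ⟨τ, hτ, hle⟩ := hlim a r hr
    obtain ⟨l, hl⟩ := pow_unbounded_of_one_lt (‖a‖ + r) hlam
    -- The limit does not depend on the centre or the initial radius: B(a, λ^i r) ⊂ B(0, λ^(i+l))
    -- with a radius ratio independent of i, so the two averages differ by O(2^(-i)).
    have hτσ : τ = σ := by
      have hsh : Tendsto (fun i : ℕ => mean 0 (lam ^ (i + l) * 1)) atTop (𝓝 σ) :=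
        hσ.comp (tendsto_add_atTop_nat l)
      set K := ENNReal.ofReal ((lam ^ l / r) ^ n) * C₁ * c * h 1
      have hK : K ≠ ∞ := ENNReal.mul_ne_top (by finiteness) (hhtop 1)
      have hle : ∀ i : ℕ, edist (mean a (lam ^ i * r)) (mean 0 (lam ^ (i + l) * 1)) ≤
          K * 2⁻¹ ^ i := by
        intro i
        refine (hmean a 0 _ _ (by positivity) (by positivity) (Metric.ball_subset_ball' ?_)).trans ?_
        · rw [dist_zero_right, mul_one, pow_add]
          have h1 : 1 ≤ lam ^ i := one_le_pow₀ hlam.le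
          nlinarith [norm_nonneg a]
        · have h1 : lam ^ (i + l) * 1 / (lam ^ i * r) = lam ^ l / r := by
            rw [pow_add]; field_simp
          rw [h1]
          simp only [K]
          rw [mul_assoc _ (h 1)]
          gcongr
          refine (hpow 1 (i + l) one_pos).trans ?_
          rw [div_eq_mul_inv, ENNReal.inv_pow]
          exact mul_le_mul' le_rfl (pow_le_pow_right_of_le_one' (by simp) (by omega))
      have hto : Tendsto (fun i : ℕ => K * (2 : ℝ≥0∞)⁻¹ ^ i) atTop (𝓝 0) := by
        have := ENNReal.Tendsto.const_mul (a := K)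
          (ENNReal.tendsto_pow_atTop_nhds_zero_of_lt_one (r := (2 : ℝ≥0∞)⁻¹) (by simp)) (.inr hK)
        simpa using this
      exact edist_le_zero.1 (le_of_tendsto_of_tendsto' (hτ.edist hsh) hto hle)
    rwa [hτσ] at hle
  have hBc0 : (8 * B : ℝ≥0∞) * c ≠ 0 := by
    simpa using ⟨(zero_lt_one.trans_le hB).ne', hc0⟩
  have hBct : (8 * B : ℝ≥0∞) * c ≠ ∞ := by finiteness
  refine ⟨σ, ?_⟩
  refine (habs φ (fun x => ‖b x - σ‖ₑ / (8 * B * c)) fun a r hr => ?_).mono hP.mono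
    fun x => le_of_eq ?_
  · set u := ENNReal.ofReal (φ r)
    calc ballAvg a r (fun x => Φ (‖b x - σ‖ₑ / (8 * B * c)))
        ≤ ballAvg a r (fun x => u + Φ (‖b x - mean a r‖ₑ / c)) := ballAvg_mono fun x _ => by
          have htri : ‖b x - σ‖ₑ ≤ ‖b x - mean a r‖ₑ + edist (mean a r) σ := by
            rw [edist_eq_enorm_sub]
            refine le_trans (le_of_eq ?_) (enorm_add_le _ _)
            rw [sub_add_sub_cancel]
          rcases le_total ‖b x - mean a r‖ₑ (edist (mean a r) σ) with hle | hle
          · refine le_trans (hP.mono ?_) ((hP.apply_half_ginv_le u).trans le_self_add)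
            rw [ENNReal.div_le_iff hBc0 hBct]
            refine htri.trans ((add_le_add hle le_rfl).trans ?_)
            rw [← two_mul]
            calc 2 * edist (mean a r) σ ≤ 2 * (2 * (B * c * h r)) := by
                  gcongr; exact hσ_le a r hr
              _ = h r * (2⁻¹ * 2) * (4 * (B * c)) := by
                  rw [ENNReal.inv_mul_cancel (by simp) (by simp)]; ring
              _ = ginv Φ u / 2 * (8 * B * c) := by
                  simp only [h, u]; rw [div_eq_mul_inv]; ring
          · refine le_trans (hP.mono ?_) le_add_self
            rw [ENNReal.div_le_iff hBc0 hBct]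
            refine htri.trans ((add_le_add le_rfl hle).trans ?_)
            rw [← two_mul]
            have hB' : (1 : ℝ≥0∞) ≤ B := by exact_mod_cast hB
            calc 2 * ‖b x - mean a r‖ₑ = 2 * (‖b x - mean a r‖ₑ / c * c) := by
                  rw [ENNReal.div_mul_cancel hc0 hc]
              _ = ‖b x - mean a r‖ₑ / c * (2 * 1 * c) := by ring
              _ ≤ ‖b x - mean a r‖ₑ / c * (8 * B * c) := by gcongr; norm_num
      _ = u + ballAvg a r (fun x => Φ (‖b x - mean a r‖ₑ / c)) := ballAvg_const_add a hr u _
      _ ≤ u + u := by gcongr; exact hmod a r hr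
      _ = (2 : ℝ≥0) * u := by push_cast; rw [two_mul]
  · have hD0 : (D : ℝ≥0∞) ≠ 0 := by simpa using (zero_lt_one.trans_le hD).ne'
    push_cast
    rw [div_eq_mul_inv, div_eq_mul_inv, div_eq_mul_inv, mul_assoc ‖b x - σ‖ₑ,
      ← ENNReal.mul_inv (.inl hBc0) (.inl hBct), mul_right_comm _ (D : ℝ≥0∞)]

end Campanato

/-! ### Measurability of the kernel -/

section Kernel

variable {n : ℕ} {ρ : ℝ → ℝ} {𝕜 : Type*} [RCLike 𝕜]

lemma nontrivial_euc (hn : 1 ≤ n) : Nontrivial (Euc n) :=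
  Module.nontrivial_of_finrank_pos (R := ℝ) (by simpa using Nat.lt_of_lt_of_le one_pos hn)

/-- Preimages under the norm of null subsets of `(0,∞)` are null. -/
lemma quasiMeasurePreserving_norm (hn : 1 ≤ n) :
    Measure.QuasiMeasurePreserving (fun x : Euc n => ‖x‖) volume (volume.restrict (Ioi 0)) := by
  have := nontrivial_euc hn
  refine ⟨measurable_norm, Measure.AbsolutelyContinuous.mk fun s hs h0 => ?_⟩
  rw [Measure.map_apply measurable_norm hs]
  -- In polar coordinates the volume of the preimage is a multiple of the integral of y^(n-1) over
  -- the null set `s`.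
  set f : ℝ → ℝ := s.indicator fun _ => 1
  have hae : (fun y : ℝ => y ^ (Module.finrank ℝ (Euc n) - 1) • f y) =ᵐ[volume.restrict (Ioi 0)]
      fun _ => 0 := by
    filter_upwards [measure_eq_zero_iff_ae_notMem.1 h0] with y hy
    simp [f, hy]
  have hint : Integrable (fun x : Euc n => f ‖x‖) volume :=
    (integrable_fun_norm_addHaar volume).2 ((integrable_zero _ _ _).congr hae.symm)
  have hzero : ∫ x : Euc n, f ‖x‖ = 0 := by
    rw [integral_fun_norm_addHaar volume f, integral_congr_ae hae]
    simp
  have hf0 : ∀ x : Euc n, 0 ≤ f ‖x‖ := fun x => indicator_nonneg (fun _ _ => zero_le_one) _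
  rw [integral_eq_zero_iff_of_nonneg hf0 hint] at hzero
  refine measure_eq_zero_iff_ae_notMem.2 ?_
  filter_upwards [hzero] with x hx hxs
  rw [mem_preimage] at hxs
  simp [f, hxs] at hx

lemma IsFractionalKernel.aestronglyMeasurable_kernel (hn : 1 ≤ n) (hρ : IsFractionalKernel ρ) :
    AEStronglyMeasurable (fun z : Euc n => ρ ‖z‖ / ‖z‖ ^ n) volume :=
  ((hρ.aemeasurable.comp_quasiMeasurePreserving (quasiMeasurePreserving_norm hn)).div
    (by fun_prop)).aestronglyMeasurable

lemma IsFractionalKernel.aestronglyMeasurable_fracIntegrand (hn : 1 ≤ n)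
    (hρ : IsFractionalKernel ρ) {f : Euc n → 𝕜} (hf : AEStronglyMeasurable f volume) (x : Euc n) :
    AEStronglyMeasurable (fracIntegrand ρ f x) volume :=
  hf.convolution_integrand_snd (ContinuousLinearMap.lsmul ℝ ℝ).flip
    (hρ.aestronglyMeasurable_kernel hn) x

lemma IsFractionalKernel.aestronglyMeasurable_fracIntegral (hn : 1 ≤ n)
    (hρ : IsFractionalKernel ρ) {f : Euc n → 𝕜} (hf : AEStronglyMeasurable f volume) :
    AEStronglyMeasurable (fracIntegral ρ f) volume :=
  (hf.convolution_integrand (ContinuousLinearMap.lsmul ℝ ℝ).flip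
    (hρ.aestronglyMeasurable_kernel hn)).integral_prod_right'

lemma IsFractionalKernel.aemeasurable_potential (hn : 1 ≤ n) (hρ : IsFractionalKernel ρ)
    {F : Euc n → ℝ≥0∞} (hF : AEMeasurable F) : AEMeasurable (potential ρ F) := by
  have h1 : AEMeasurable (fun p : Euc n × Euc n => ‖ρ ‖p.1 - p.2‖ / ‖p.1 - p.2‖ ^ n‖ₑ)
      (volume.prod volume) :=
    (hρ.aestronglyMeasurable_kernel hn).aemeasurable.enorm.comp_quasiMeasurePreserving
      (quasiMeasurePreserving_sub_of_right_invariant volume volume)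
  exact (h1.mul (hF.comp_quasiMeasurePreserving
    Measure.quasiMeasurePreserving_snd)).lintegral_prod_right'

lemma potential_const_mul {c : ℝ≥0∞} (hc : c ≠ ∞) (F : Euc n → ℝ≥0∞) (x : Euc n) :
    potential ρ (fun y => c * F y) x = c * potential ρ F x := by
  rw [potential, potential, ← lintegral_const_mul' _ _ hc]
  congr with y
  ring

lemma lintegral_enorm_fracIntegrand (f : Euc n → 𝕜) (x : Euc n) :
    ∫⁻ y, ‖fracIntegrand ρ f x y‖ₑ = potential ρ (fun y => ‖f y‖ₑ) x := by
  simp only [fracIntegrand, potential, enorm_smul]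

lemma enorm_fracIntegral_le (f : Euc n → 𝕜) (x : Euc n) :
    ‖fracIntegral ρ f x‖ₑ ≤ potential ρ (fun y => ‖f y‖ₑ) x :=
  (enorm_integral_le_lintegral_enorm _).trans_eq (lintegral_enorm_fracIntegrand f x)

/-- The commutator does not change when a constant is subtracted from the symbol. -/
lemma fracCommutator_eq {b f : Euc n → 𝕜} {σ : 𝕜} {x : Euc n}
    (hf : Integrable (fracIntegrand ρ f x) volume)
    (hg : Integrable (fracIntegrand ρ (fun y => (b y - σ) * f y) x) volume) :
    Integrable (fracIntegrand ρ (fun y => b y * f y) x) volume ∧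
      fracCommutator ρ b f x =
        (b x - σ) * fracIntegral ρ f x - fracIntegral ρ (fun y => (b y - σ) * f y) x := by
  have heq : fracIntegrand ρ (fun y => b y * f y) x =
      fun y => fracIntegrand ρ (fun y => (b y - σ) * f y) x y + σ * fracIntegrand ρ f x y := by
    ext y
    simp only [fracIntegrand]
    rw [mul_smul_comm, ← smul_add]
    congr 1
    ring
  refine ⟨heq ▸ hg.add (hf.const_mul σ), ?_⟩
  rw [fracCommutator, fracIntegral, fracIntegral, fracIntegral, heq,
    integral_add hg (hf.const_mul σ), integral_const_mul]
  ring

end Kernel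

/-! ### Norms and modular inequalities -/

section Modular

variable {n : ℕ} {Φ Φ₀ Ψ Ψ₀ Θ : ℝ≥0∞ → ℝ≥0∞} {φ ρ : ℝ → ℝ} {𝕜 : Type*} [RCLike 𝕜]

/-- Norms are always compared with strictly larger constants, so it never matters whether the
defining infimum is attained. -/
lemma ballAvg_le_of_ballNorm_lt (hΦ : Monotone Φ) {a : Euc n} {r : ℝ} (hr : 0 < φ r)
    {f : Euc n → 𝕜} {c : ℝ≥0∞} (h : ballNorm Φ φ a r f < c) :
    ballAvg a r (fun x => Φ (‖f x‖ₑ / c)) ≤ ENNReal.ofReal (φ r) := by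
  obtain ⟨c', ⟨-, -, hc'⟩, hlt⟩ := sInf_lt_iff.1 h
  rw [ENNReal.inv_mul_le_iff (by simpa using hr) ENNReal.ofReal_ne_top, mul_one] at hc'
  exact (ballAvg_mono fun x _ => hΦ (by gcongr)).trans hc'

lemma ballNorm_lt_of_iSup_lt {N : Euc n → ℝ → ℝ≥0∞} {c : ℝ≥0∞}
    (h : ⨆ (a : Euc n) (r : ℝ) (_ : 0 < r), N a r < c) (a : Euc n) (r : ℝ) (hr : 0 < r) :
    N a r < c :=
  lt_of_le_of_lt (le_iSup_of_le a (le_iSup₂ (f := fun r (_ : 0 < r) => N a r) r hr)) h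

lemma modularLE_of_morreyNorm_lt (hφ : IsGdec n φ) (hΦ : Monotone Φ) {f : Euc n → 𝕜} {c : ℝ≥0∞}
    (h : morreyNorm Φ φ f < c) : ModularLE Φ φ (fun x => ‖f x‖ₑ / c) := fun a r hr =>
  ballAvg_le_of_ballNorm_lt hΦ (hφ.pos r hr) (ballNorm_lt_of_iSup_lt h a r hr)

lemma morreyNorm_le_of_modularLE (hφ : IsGdec n φ) {f : Euc n → 𝕜} {c : ℝ≥0∞} (hc0 : c ≠ 0)
    (hc : c ≠ ∞) (h : ModularLE Φ φ (fun x => ‖f x‖ₑ / c)) : morreyNorm Φ φ f ≤ c := by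
  refine iSup_le fun a => iSup₂_le fun r hr => sInf_le ⟨pos_iff_ne_zero.2 hc0, hc, ?_⟩
  rw [ENNReal.inv_mul_le_iff (hφ.ofReal_ne_zero hr) ENNReal.ofReal_ne_top, mul_one]
  exact h a r hr

lemma ModularLE.mono_ae (hΦ : Monotone Φ) {F G : Euc n → ℝ≥0∞} (h : ModularLE Φ φ G)
    (hFG : ∀ᵐ x, F x ≤ G x) : ModularLE Φ φ F := by
  intro a r hr
  refine le_trans ?_ (h a r hr)
  change ballAvg a r _ ≤ ballAvg a r _
  rw [ballAvg_eq, ballAvg_eq]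
  gcongr 1
  exact lintegral_mono_ae (ae_restrict_of_ae (hFG.mono fun x hx => hΦ hx))

/-- Φ(∞) = ∞, while Φ(F) has finite integral over every ball of an exhaustion. Applied to
potentials, this gives absolute convergence almost everywhere. -/
lemma ModularLE.ae_lt_top (hΦ : IsPhi Φ) {F : Euc n → ℝ≥0∞} (hF : AEMeasurable F)
    (h : ModularLE Φ φ F) : ∀ᵐ x, F x < ∞ := by
  have hk : ∀ k : ℕ, ∀ᵐ x, x ∈ Metric.ball (0 : Euc n) (k + 1) → F x < ∞ := by
    intro k
    have h1 := (ballAvg_le_iff 0 (by positivity : (0 : ℝ) < k + 1) _ _).1 (h 0 (k + 1) (by positivity))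
    have h2 := ae_lt_top' (hΦ.mono.measurable.comp_aemeasurable hF.restrict)
      (ne_top_of_le_ne_top (ENNReal.mul_ne_top ENNReal.ofReal_ne_top (volume_ball_ne_top _ _)) h1)
    rw [ae_restrict_iff' Metric.isOpen_ball.measurableSet] at h2
    filter_upwards [h2] with x hx hxk
    refine lt_top_iff_ne_top.2 fun hc => ?_
    have := hx hxk
    rw [Function.comp, hc, hΦ.apply_top] at this
    exact lt_irrefl _ this
  filter_upwards [ae_all_iff.2 hk] with x hx
  obtain ⟨k, hkx⟩ := exists_nat_gt ‖x‖
  exact hx k (by rw [mem_ball_zero_iff]; linarith)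

/-- The quasi-triangle inequality: (F + G)/2 is at most the larger of the two, so Ψ of it is at most
Ψ(F) + Ψ(G), and the resulting factor 2 is absorbed by a dilation. -/
lemma QuasiConvex.exists_modularLE_add (hΨ : IsPhi Ψ) (hq : QuasiConvex Ψ) :
    ∃ D : ℝ≥0, 1 ≤ D ∧ ∀ (φ : ℝ → ℝ) (F G : Euc n → ℝ≥0∞), AEMeasurable F → ModularLE Ψ φ F →
      ModularLE Ψ φ G → ModularLE Ψ φ (fun x => (F x + G x) / D) := by
  obtain ⟨D, hD, habs⟩ := hq.exists_modularLE_div (n := n) hΨ (l := 2) (by norm_num)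
  refine ⟨2 * D, one_le_mul (by norm_num) hD, fun φ F G hFm hF hG => ?_⟩
  refine (habs φ (fun x => (F x + G x) / 2) fun a r hr => ?_).mono hΨ.mono fun x => le_of_eq ?_
  · calc ballAvg a r (fun x => Ψ ((F x + G x) / 2))
        ≤ ballAvg a r (fun x => Ψ (F x) + Ψ (G x)) := ballAvg_mono fun x _ => by
          rcases le_total (F x) (G x) with hle | hle
          · refine le_trans (hΨ.mono (ENNReal.div_le_of_le_mul ?_)) le_add_self
            rw [mul_two]; gcongr
          · refine le_trans (hΨ.mono (ENNReal.div_le_of_le_mul ?_)) le_self_add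
            rw [mul_two]; gcongr
      _ = ballAvg a r (fun x => Ψ (F x)) + ballAvg a r (fun x => Ψ (G x)) :=
          ballAvg_add (hΨ.mono.measurable.comp_aemeasurable hFm) _
      _ ≤ ENNReal.ofReal (φ r) + ENNReal.ofReal (φ r) := add_le_add (hF a r hr) (hG a r hr)
      _ = _ := by push_cast; rw [two_mul]
  · push_cast
    rw [div_eq_mul_inv, div_eq_mul_inv, div_eq_mul_inv, ENNReal.mul_inv (by simp) (by simp),
      mul_assoc]

/-- Hölder's inequality in modular form. -/
lemma QuasiConvex.exists_modularLE_mul (hΨ : IsPhi Ψ) (hq : QuasiConvex Ψ) (hΦ : Monotone Φ)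
    (hΦ₀ : Monotone Φ₀) (h : Dominated (fun u => ginv Φ u * ginv Φ₀ u) (ginv Ψ)) :
    ∃ D : ℝ≥0, 0 < D ∧ ∀ (φ : ℝ → ℝ) (F G : Euc n → ℝ≥0∞), AEMeasurable F → ModularLE Φ φ F →
      ModularLE Φ₀ φ G → ModularLE Ψ φ (fun x => F x * G x / D) := by
  obtain ⟨C, hC, h⟩ := h
  obtain ⟨D, hD, habs⟩ := hq.exists_modularLE_div (n := n) hΨ (l := 2) (by norm_num)
  have hD0 : 0 < D := zero_lt_one.trans_le hD
  refine ⟨2 * C * D, by positivity, fun φ F G hFm hF hG => ?_⟩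
  refine (habs φ (fun x => F x * G x / (2 * C)) fun a r hr => ?_).mono hΨ.mono
    fun x => le_of_eq ?_
  · calc ballAvg a r (fun x => Ψ (F x * G x / (2 * C)))
        ≤ ballAvg a r (fun x => Φ (F x) + Φ₀ (G x)) :=
          ballAvg_mono fun x _ => hΨ.apply_mul_le hΦ hΦ₀ hC h _ _
      _ = ballAvg a r (fun x => Φ (F x)) + ballAvg a r (fun x => Φ₀ (G x)) :=
          ballAvg_add (hΦ.measurable.comp_aemeasurable hFm) _
      _ ≤ ENNReal.ofReal (φ r) + ENNReal.ofReal (φ r) := add_le_add (hF a r hr) (hG a r hr)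
      _ = _ := by push_cast; rw [two_mul]
  · push_cast
    rw [div_eq_mul_inv, div_eq_mul_inv, div_eq_mul_inv,
      ENNReal.mul_inv (b := (D : ℝ≥0∞)) (by simp) (by simp [hD0.ne']), mul_assoc (F x * G x)]

lemma Comparable.dominated {P Q : ℝ≥0∞ → ℝ≥0∞} (h : Comparable P Q) : Dominated P Q := by
  obtain ⟨C, hC, h⟩ := h
  refine ⟨C, hC, fun t => ?_⟩
  have := (h t).1
  rwa [ENNReal.inv_mul_le_iff (by simpa using hC.ne') (by simp)] at this

/-- For t ≥ r the factor Φ₀⁻¹(φ(t)) of Ψ₀⁻¹(φ(t)) is at most a multiple of Φ₀⁻¹(φ(r)) and leaves the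
integral. The condition for Φ and Θ remains, and Φ₀⁻¹Θ⁻¹ ≲ Ψ⁻¹ finishes. -/
lemma FractionalCondition.of_comparable (hc : FractionalCondition ρ φ Φ Θ) (hφ : IsGdec n φ)
    (hΦ₀ : IsPhi Φ₀) (hq₀ : QuasiConvex Φ₀)
    (hΦΦ₀ : Comparable (fun u => ginv Φ u * ginv Φ₀ u) (ginv Ψ₀))
    (hΦ₀Θ : Dominated (fun u => ginv Φ₀ u * ginv Θ u) (ginv Ψ)) :
    FractionalCondition ρ φ Ψ₀ Ψ := by
  obtain ⟨C₀, hC₀, hc⟩ := hc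
  obtain ⟨C₁, hC₁, h₁⟩ := hΦΦ₀
  obtain ⟨D, hD, hdom⟩ := hΦ₀Θ
  obtain ⟨C₂, hC₂, hginv⟩ := hq₀.exists_ginv_le hφ le_rfl
  have hC₂0 : 0 < C₂ := zero_lt_one.trans_le hC₂
  refine ⟨C₁ * C₂ * C₀ * D, by positivity, fun r hr => ?_⟩
  set g := ginv Φ₀ (ENNReal.ofReal (φ r))
  have hg : g ≠ ∞ := (hΦ₀.ginv_lt_top ENNReal.ofReal_ne_top).ne
  have hpt : ∀ t, r ≤ t → ginv Ψ₀ (ENNReal.ofReal (φ t)) ≤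
      C₁ * C₂ * g * ginv Φ (ENNReal.ofReal (φ t)) := by
    intro t ht
    calc ginv Ψ₀ (ENNReal.ofReal (φ t))
        ≤ C₁ * (ginv Φ (ENNReal.ofReal (φ t)) * ginv Φ₀ (ENNReal.ofReal (φ t))) := (h₁ _).2
      _ ≤ C₁ * (ginv Φ (ENNReal.ofReal (φ t)) * (C₂ * g)) := by
          gcongr
          exact hginv r t hr (hr.trans_le ht) (by simpa using ht)
      _ = _ := by ring
  set X := ∫⁻ t in Ioo 0 r, ENNReal.ofReal (ρ t / t)
  calc X * ginv Ψ₀ (ENNReal.ofReal (φ r)) +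
        ∫⁻ t in Ioi r, ENNReal.ofReal (ρ t / t) * ginv Ψ₀ (ENNReal.ofReal (φ t))
      ≤ X * (C₁ * C₂ * g * ginv Φ (ENNReal.ofReal (φ r))) +
        ∫⁻ t in Ioi r, C₁ * C₂ * g *
          (ENNReal.ofReal (ρ t / t) * ginv Φ (ENNReal.ofReal (φ t))) := by
        refine add_le_add (mul_le_mul' le_rfl (hpt r le_rfl))
          (setLIntegral_mono' measurableSet_Ioi fun t ht => ?_)
        rw [mul_left_comm]
        exact mul_le_mul' le_rfl (hpt t (le_of_lt ht))
    _ = C₁ * C₂ * g * (X * ginv Φ (ENNReal.ofReal (φ r)) +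
        ∫⁻ t in Ioi r, ENNReal.ofReal (ρ t / t) * ginv Φ (ENNReal.ofReal (φ t))) := by
        rw [lintegral_const_mul' _ _ (by finiteness)]
        ring
    _ ≤ C₁ * C₂ * g * (C₀ * ginv Θ (ENNReal.ofReal (φ r))) := by gcongr; exact hc r hr
    _ = C₁ * C₂ * C₀ * (g * ginv Θ (ENNReal.ofReal (φ r))) := by ring
    _ ≤ C₁ * C₂ * C₀ * (D * ginv Ψ (ENNReal.ofReal (φ r))) := mul_le_mul' le_rfl (hdom _)
    _ = _ := by push_cast; ring

/-- The commutator estimate in modular form. -/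
lemma exists_modularLE_fracCommutator (hn : 1 ≤ n) (hΦ : IsNabla2 Φ) (hΦ₀ : IsDelta2 Φ₀)
    (hΨ : IsGenYoung Ψ) (hφ : IsGdec n φ) (hφint : IntegralCondition φ)
    (hρ : IsFractionalKernel ρ) (hΨ₀ : IsNabla2 Ψ₀) (hΘ : IsGenYoung Θ)
    (hΦΦ₀ : Comparable (fun u => ginv Φ u * ginv Φ₀ u) (ginv Ψ₀))
    (hΦ₀Θ : Dominated (fun u => ginv Φ₀ u * ginv Θ u) (ginv Ψ))
    (hρΘ : FractionalCondition ρ φ Φ Θ) :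
    ∃ C : ℝ≥0, 0 < C ∧ ∀ (b f : Euc n → 𝕜) (c d : ℝ≥0∞), LocallyIntegrable b volume →
      AEStronglyMeasurable f volume → campanatoNorm Φ₀ φ b < c → c ≠ ∞ → morreyNorm Φ φ f < d →
      d ≠ ∞ →
      (∀ᵐ x ∂(volume : Measure (Euc n)), Integrable (fracIntegrand ρ f x) volume ∧
        Integrable (fracIntegrand ρ (fun y => b y * f y) x) volume) ∧
      ModularLE Ψ φ (fun x => ‖fracCommutator ρ b f x‖ₑ / (C * c * d)) := by
  have hq₀ : QuasiConvex Φ₀ := hΨ₀.quasiConvex.of_comparable hΦ.isPhi hΦΦ₀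
  have hqΨ := hΨ.quasiConvex
  have hρΨ : FractionalCondition ρ φ Ψ₀ Ψ := hρΘ.of_comparable hφ hΦ₀.isPhi hq₀ hΦΦ₀ hΦ₀Θ
  obtain ⟨A, hA, hcamp⟩ := hΦ₀.exists_modularLE_sub_const (n := n) (𝕜 := 𝕜) hq₀ hφ hφint
  obtain ⟨L₁, hL₁, hpot₁⟩ := hΦ.exists_modularLE_potential hn hΘ.isPhi hΘ.quasiConvex hφ hφint hρ hρΘ
  obtain ⟨L₂, hL₂, hpot₂⟩ := hΨ₀.exists_modularLE_potential hn hΨ.isPhi hqΨ hφ hφint hρ hρΨ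
  obtain ⟨D₁, hD₁, hmul₁⟩ := hqΨ.exists_modularLE_mul (n := n) hΨ.isPhi hΦ₀.isPhi.mono
    hΘ.isPhi.mono hΦ₀Θ
  obtain ⟨D₂, hD₂, hmul₂⟩ := hΨ₀.quasiConvex.exists_modularLE_mul (n := n) hΨ₀.isPhi hΦ.isPhi.mono
    hΦ₀.isPhi.mono hΦΦ₀.dominated
  obtain ⟨D₃, hD₃, hadd⟩ := hqΨ.exists_modularLE_add (n := n) hΨ.isPhi
  have hA0 : (A : ℝ≥0∞) ≠ 0 := by simpa using (zero_lt_one.trans_le hA).ne'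
  have hL₁0 : (L₁ : ℝ≥0∞) ≠ 0 := by simpa using (zero_lt_one.trans_le hL₁).ne'
  have hL₂0 : (L₂ : ℝ≥0∞) ≠ 0 := by simpa using (zero_lt_one.trans_le hL₂).ne'
  have hD₁0 : (D₁ : ℝ≥0∞) ≠ 0 := by simpa using hD₁.ne'
  have hD₂0 : (D₂ : ℝ≥0∞) ≠ 0 := by simpa using hD₂.ne'
  have hD₃0 : (D₃ : ℝ≥0∞) ≠ 0 := by simpa using (zero_lt_one.trans_le hD₃).ne'
  set K : ℝ≥0 := A * (D₁ * L₁ + D₂ * L₂) * D₃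
  have hK : 0 < K := by
    have := zero_lt_one.trans_le hA
    have := zero_lt_one.trans_le hL₁
    have := zero_lt_one.trans_le hD₃
    positivity
  refine ⟨K, hK, fun b f c d hb hf hbc hc hfd hd => ?_⟩
  have hc0 : c ≠ 0 := (pos_of_gt hbc).ne'
  have hd0 : d ≠ 0 := (pos_of_gt hfd).ne'
  obtain ⟨σ, hσ⟩ := hcamp b c hb hc0 hc fun a r hr =>
    ballAvg_le_of_ballNorm_lt hΦ₀.isPhi.mono (hφ.pos r hr) (ballNorm_lt_of_iSup_lt hbc a r hr)
  set F : Euc n → ℝ≥0∞ := fun x => ‖f x‖ₑ / d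
  set G : Euc n → ℝ≥0∞ := fun x => ‖b x - σ‖ₑ / (A * c)
  set H : Euc n → ℝ≥0∞ := fun x => F x * G x / D₂
  have hAc0 : (A : ℝ≥0∞) * c ≠ 0 := mul_ne_zero hA0 hc0
  have hAct : (A : ℝ≥0∞) * c ≠ ∞ := by finiteness
  have hbσ : AEStronglyMeasurable (fun y => b y - σ) volume :=
    hb.aestronglyMeasurable.sub aestronglyMeasurable_const
  have hFm : AEMeasurable F := hf.enorm.div_const _
  have hGm : AEMeasurable G := hbσ.enorm.div_const _
  have hHm : AEMeasurable H := (hFm.mul hGm).div_const _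
  have hFmod : ModularLE Φ φ F := modularLE_of_morreyNorm_lt hφ hΦ.isPhi.mono hfd
  have hHmod : ModularLE Ψ₀ φ H := hmul₂ φ F G hFm hFmod hσ
  have hpF := hpot₁ F hFm hFmod
  have hpH := hpot₂ H hHm hHmod
  have hpFm := hρ.aemeasurable_potential hn hFm
  have hpHm := hρ.aemeasurable_potential hn hHm
  -- The summands stand for |b - σ| I_ρ|f|, by Hölder after the bound from Φ to Θ, and for I_ρ(|b -
  -- σ||f|), by the bound from Ψ₀ to Ψ after Hölder.
  have hT := hadd φ _ _ ((hGm.mul (hpFm.div_const _)).div_const _)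
    (hmul₁ φ G _ hGm hσ hpF) hpH
  have hfF : (fun y => ‖f y‖ₑ) = fun y => d * F y := by
    ext y
    simp only [F]
    rw [ENNReal.mul_div_cancel hd0 hd]
  have hgH : (fun y => ‖(b y - σ) * f y‖ₑ) = fun y => (A * c * d * D₂) * H y := by
    ext y
    simp only [H, enorm_mul]
    rw [mul_assoc, ENNReal.mul_div_cancel hD₂0 (by simp)]
    calc ‖b y - σ‖ₑ * ‖f y‖ₑ = (A * c * G y) * (d * F y) := by
          simp only [F, G]
          rw [ENNReal.mul_div_cancel hd0 hd, ENNReal.mul_div_cancel hAc0 hAct]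
      _ = _ := by ring
  have hint : ∀ᵐ x ∂(volume : Measure (Euc n)), Integrable (fracIntegrand ρ f x) volume ∧
      Integrable (fracIntegrand ρ (fun y => (b y - σ) * f y) x) volume := by
    filter_upwards [hpF.ae_lt_top hΘ.isPhi (hpFm.div_const _),
      hpH.ae_lt_top hΨ.isPhi (hpHm.div_const _)] with x hx₁ hx₂
    have hx₁' : potential ρ F x ≠ ∞ := by
      rintro h; simp [h, ENNReal.top_div] at hx₁
    have hx₂' : potential ρ H x ≠ ∞ := by
      rintro h; simp [h, ENNReal.top_div] at hx₂
    refine ⟨⟨hρ.aestronglyMeasurable_fracIntegrand hn hf x, ?_⟩,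
      ⟨hρ.aestronglyMeasurable_fracIntegrand hn (hbσ.mul hf) x, ?_⟩⟩
    · rw [hasFiniteIntegral_iff_enorm, lintegral_enorm_fracIntegrand, hfF, potential_const_mul hd]
      finiteness
    · rw [hasFiniteIntegral_iff_enorm, lintegral_enorm_fracIntegrand, hgH,
        potential_const_mul (by finiteness)]
      finiteness
  refine ⟨hint.mono fun x hx => ⟨hx.1, (fracCommutator_eq hx.1 hx.2).1⟩, ?_⟩
  refine hT.mono_ae hΨ.isPhi.mono (hint.mono fun x hx => ?_)
  have hKcd : (K : ℝ≥0∞) * c * d ≠ 0 := mul_ne_zero (mul_ne_zero (by simpa using hK.ne') hc0) hd0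
  rw [ENNReal.div_le_iff hKcd (by finiteness), (fracCommutator_eq hx.1 hx.2).2]
  set p := potential ρ F x
  set q := potential ρ H x
  have hp : p = L₁ * (p / L₁) := (ENNReal.mul_div_cancel hL₁0 (by simp)).symm
  have hq : q = L₂ * (q / L₂) := (ENNReal.mul_div_cancel hL₂0 (by simp)).symm
  set s := G x * (p / L₁) / D₁
  have hs : G x * (p / L₁) = D₁ * s := (ENNReal.mul_div_cancel hD₁0 (by simp)).symm
  set t := q / L₂
  calc ‖(b x - σ) * fracIntegral ρ f x - fracIntegral ρ (fun y => (b y - σ) * f y) x‖ₑ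
      ≤ ‖b x - σ‖ₑ * ‖fracIntegral ρ f x‖ₑ + ‖fracIntegral ρ (fun y => (b y - σ) * f y) x‖ₑ := by
        rw [← enorm_mul]; exact enorm_sub_le
    _ ≤ (A * c * G x) * (d * p) + (A * c * d * D₂) * q := by
        refine add_le_add (mul_le_mul' (le_of_eq ?_) ?_) ?_
        · exact (ENNReal.mul_div_cancel hAc0 hAct).symm
        · refine (enorm_fracIntegral_le f x).trans_eq ?_
          rw [hfF, potential_const_mul hd]
        · refine (enorm_fracIntegral_le _ x).trans_eq ?_
          rw [hgH, potential_const_mul (by finiteness)]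
    _ = A * c * d * (D₁ * L₁ * s + D₂ * L₂ * t) := by
        rw [hq]
        calc _ = A * c * d * (G x * p + D₂ * L₂ * t) := by ring
          _ = _ := by
            rw [hp]
            calc _ = A * c * d * (L₁ * (G x * (p / L₁)) + D₂ * L₂ * t) := by ring
              _ = _ := by rw [hs]; ring
    _ ≤ A * c * d * ((D₁ * L₁ + D₂ * L₂) * s + (D₁ * L₁ + D₂ * L₂) * t) := by
        gcongr
        · exact le_self_add
        · exact le_add_self
    _ = (s + t) / D₃ * D₃ * (A * c * d * (D₁ * L₁ + D₂ * L₂)) := by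
        rw [ENNReal.div_mul_cancel hD₃0 (by simp)]; ring
    _ = (s + t) / D₃ * (K * c * d) := by
        simp only [K]; push_cast; ring

end Modular

end OrliczMorrey

/-! ### From the modular estimate to the norm inequality -/

theorem mainTheorem8 {𝕜 : Type*} [RCLike 𝕜] (n : ℕ) (hn : 1 ≤ n)
    (Φ Φ₀ Ψ Ψ₀ Θ : ℝ≥0∞ → ℝ≥0∞) (φ ρ : ℝ → ℝ)
    (hΦ : IsNabla2 Φ) (hΦ₀ : IsDelta2 Φ₀) (hΨ : IsGenYoung Ψ)
    (hφ : IsGdec n φ) (hφint : IntegralCondition φ) (hρ : IsFractionalKernel ρ)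
    (hΨ₀ : IsNabla2 Ψ₀) (hΘ : IsGenYoung Θ)
    (hΦΦ₀ : Comparable (fun u => ginv Φ u * ginv Φ₀ u) (ginv Ψ₀))
    (hΦ₀Θ : Dominated (fun u => ginv Φ₀ u * ginv Θ u) (ginv Ψ))
    (hρΘ : FractionalCondition ρ φ Φ Θ) :
    ∃ C : ℝ≥0, 0 < C ∧
      ∀ b : EuclideanSpace ℝ (Fin n) → 𝕜, MemCampanato Φ₀ φ b →
      ∀ f : EuclideanSpace ℝ (Fin n) → 𝕜, MemMorrey Φ φ f →
        (∀ᵐ x ∂(volume : Measure (EuclideanSpace ℝ (Fin n))),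
          Integrable (fracIntegrand ρ f x) volume ∧
          Integrable (fracIntegrand ρ (fun y => b y * f y) x) volume) ∧
        MemMorrey Ψ φ (fracCommutator ρ b f) ∧
        morreyNorm Ψ φ (fracCommutator ρ b f) ≤
          (C : ℝ≥0∞) * campanatoNorm Φ₀ φ b * morreyNorm Φ φ f := by
  obtain ⟨C, hC, hmain⟩ := exists_modularLE_fracCommutator (𝕜 := 𝕜) hn hΦ hΦ₀ hΨ hφ hφint hρ hΨ₀ hΘ
    hΦΦ₀ hΦ₀Θ hρΘ
  have hC0 : (C : ℝ≥0∞) ≠ 0 := by simpa using hC.ne'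
  refine ⟨C, hC, fun b hb f hf => ?_⟩
  obtain ⟨c, hbc, hc⟩ := exists_between hb.2
  obtain ⟨d, hfd, hd⟩ := exists_between hf.2
  have hle : morreyNorm Ψ φ (fracCommutator ρ b f) ≤
      (C : ℝ≥0∞) * campanatoNorm Φ₀ φ b * morreyNorm Φ φ f := by
    rw [mul_assoc, mul_comm, ← ENNReal.div_le_iff hC0 (by simp)]
    -- The modular estimate holds for all c and d strictly above the two norms; letting them
    -- decrease covers vanishing norms as well.
    refine ENNReal.le_mul_of_forall_lt (.inr hf.2.ne) (.inl hb.2.ne) fun c hbc d hfd => ?_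
    have hc0 : c ≠ 0 := (pos_of_gt hbc).ne'
    have hd0 : d ≠ 0 := (pos_of_gt hfd).ne'
    rcases eq_or_ne c ∞ with rfl | hc
    · rw [ENNReal.top_mul hd0]; exact le_top
    rcases eq_or_ne d ∞ with rfl | hd
    · rw [ENNReal.mul_top hc0]; exact le_top
    rw [ENNReal.div_le_iff hC0 (by simp), mul_comm, ← mul_assoc]
    exact morreyNorm_le_of_modularLE hφ (mul_ne_zero (mul_ne_zero hC0 hc0) hd0) (by finiteness)
      (hmain b f c d hb.1 hf.1 hbc hc hfd hd).2
  -- Measurability comes from that of parameter integrals on the product space and needs no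
  -- convergence.
  have hcomm : AEStronglyMeasurable (fracCommutator ρ b f) volume :=
    (hb.1.aestronglyMeasurable.mul (hρ.aestronglyMeasurable_fracIntegral hn hf.1)).sub
      (hρ.aestronglyMeasurable_fracIntegral hn (hb.1.aestronglyMeasurable.mul hf.1))
  refine ⟨(hmain b f c d hb.1 hf.1 hbc hc.ne hfd hd.ne).1, ⟨hcomm, hle.trans_lt ?_⟩, hle⟩
  exact ENNReal.mul_lt_top (ENNReal.mul_lt_top (by simp) hb.2) hf.2
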